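/- Let $\alpha\in(0,1/3)$, $p_1=(0,0)$, $p_2=(\tfrac12,\tfrac{\sqrt3}{2})$, $p_3=(1,0)$, $p_4=\frac{p_2+p_3}2$, $p_5=\frac{p_1+p_3}2$, $p_6=\frac{p_1+p_2}2$, and $G_i(x)=A_i(x-p_i)+p_i$ on $\mathbb R^2$, where $A_1=A_2=A_3=\frac{1-\alpha}{2}I_2$, $A_4=\frac\alpha4\begin{pmatrix}1&-\sqrt3\\-\sqrt3&3\end{pmatrix}$, $A_5=\alpha\begin{pmatrix}1&0\\0&0\end{pmatrix}$, $A_6=\frac\alpha4\begin{pmatrix}1&\sqrt3\\\sqrt3&3\end{pmatrix}$. The Hanoi attractor $K_\alpha$ is the unique nonempty compact set with $K_\alpha=\bigcup_{i=1}^6G_i(K_\alpha)$. For a word $w=w_1\cdots w_n\in\{1,2,3\}^n$ let $G_w=G_{w_1}\circ\cdots\circ G_{w_n}$. For $\{i,j,k\}=\{1,2,3\}$ let $e_i$ be the segment joining $G_j(p_k)$ and $G_k(p_j)$; for each segment $e=G_w(e_i)$ with endpoints $a_e,b_e$ put $\varphi_e(t)=a_e+t(b_e-a_e)$, $t\in[0,1]$.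 Let $d_k=\alpha(\frac{1-\alpha}2)^{k-1}$ for $k\ge1$, $\rho^d_n=\prod_{k=1}^n\frac{3}{5+3d_k}$ and $\rho^c_k=\rho^d_{k-1}\frac{3d_k}{5+3d_k}$. For a continuous $u:K_\alpha\to\mathbb R$ such that $u\circ\varphi_e\in H^1(0,1)$ for all these segments $e$ (in the sense that $u\circ\varphi_e$ is absolutely continuous on $[0,1]$ with square integrable derivative), let $$\mathcal E_n[u]=\frac1{\rho^d_n}\sum_{|w|=n}\ \sum_{1\le i<j\le3}\bigl(u(G_w(p_i))-u(G_w(p_j))\bigr)^2+\sum_{k=1}^n\frac1{\rho^c_k}\sum_{|w|=k-1}\ \sum_{i=1}^3\int_0^1\bigl|(u\circ\varphi_{G_w(e_i)})'\bigr|^2dt .$$ Let $\mathcal F$ be the set of all such $u$ for which $\mathcal E[u]:=\lim_{n\to\infty}\mathcal E_n[u]$ exists and is finite, and let $\mathcal E(u,v)=\frac12(\mathcal E[u+v]-\mathcal E[u]-\mathcal E[v])$ for $u,v\in\mathcal F$. Theorem. Let $\mu$ be a finite Radon measure on $K_\alpha$ with full support, i.e. $\mu(U)>0$ for every nonempty relatively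 open $U\subseteq K_\alpha$. Then $\mathcal F\subseteq L^2(K_\alpha,\mu)$, and the closure $\mathcal D$ of $C_0(K_\alpha)\cap\mathcal F$ in $\mathcal F$ with respect to the norm $\bigl(\mathcal E(u,u)+\int u^2\,d\mu\bigr)^{1/2}$ is $\mathcal D=\mathcal F$, where $C_0(K_\alpha)$ denotes the continuous functions with compact support. Moreover $(\mathcal E,\mathcal D)$, with functions in $\mathcal D$ identified with their classes in $L^2(K_\alpha,\mu)$, is a well-defined Dirichlet form on $L^2(K_\alpha,\mu)$ (a non-negative symmetric bilinear form which is densely defined, closed and Markovian), and it is (i) local: $\mathcal E(u,v)=0$ whenever $u,v\in\mathcal D$ have disjoint compact supports; (ii) regular: $C_0(K_\alpha)\cap\mathcal D$ is dense in $\mathcal D$ with respect to the above norm and dense in $C_0(K_\alpha)$ with respect to the uniform norm. -/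

import Mathlib

open MeasureTheory Filter Topology

noncomputable section

/-! ### Symmetric Dirichlet forms on an `L²`-space -/

section DirichletForms

variable {X : Type*} [MeasurableSpace X]

/-- A Dirichlet form on the real Hilbert space `L²(X, μ)`: a non-negative symmetric bilinear form
on a dense linear subspace (the domain), which is closed (the domain is complete for the norm
`(𝓔(f, f) + ‖f‖²)^{1/2}`) and Markovian (the unit contraction `(0 ∨ f) ∧ 1` operates on it). -/
structure DirichletForm (μ : Measure X) where
  domain : Submodule ℝ (Lp ℝ 2 μ)
  form : domain →ₗ[ℝ] domain →ₗ[ℝ] ℝ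
  dense_domain : Dense (domain : Set (Lp ℝ 2 μ))
  symm : ∀ f g : domain, form f g = form g f
  nonneg : ∀ f : domain, 0 ≤ form f f
  complete : ∀ f : ℕ → domain,
    (∀ ε > 0, ∃ N : ℕ, ∀ m ≥ N, ∀ n ≥ N,
      form (f m - f n) (f m - f n) + ‖((f m - f n : domain) : Lp ℝ 2 μ)‖ ^ 2 < ε) →
    ∃ g : domain, Tendsto
      (fun n => form (f n - g) (f n - g) + ‖((f n - g : domain) : Lp ℝ 2 μ)‖ ^ 2) atTop (𝓝 0)
  markov : ∀ f : domain, ∃ g : domain,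
    ((g : Lp ℝ 2 μ) : X → ℝ) =ᵐ[μ] (fun x => min (max (((f : Lp ℝ 2 μ) : X → ℝ) x) 0) 1) ∧
      form g g ≤ form f f

/-- The support of (the `μ`-class of) a function `f`: the complement of the largest open set on
which `f` vanishes `μ`-almost everywhere (on a second countable space). -/
def aeSupport [TopologicalSpace X] (μ : Measure X) (f : X → ℝ) : Set X :=
  {x | ∀ U ∈ 𝓝 x, μ (U ∩ Function.support f) ≠ 0}

variable [TopologicalSpace X] {μ : Measure X}

/-- `𝓔` is local: `𝓔(f, g) = 0` for all `f, g` in the domain with disjoint compact supports. -/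
def DirichletForm.IsLocal (𝓔 : DirichletForm μ) : Prop :=
  ∀ f g : 𝓔.domain,
    IsCompact (aeSupport μ ((f : Lp ℝ 2 μ) : X → ℝ)) →
    IsCompact (aeSupport μ ((g : Lp ℝ 2 μ) : X → ℝ)) →
    Disjoint (aeSupport μ ((f : Lp ℝ 2 μ) : X → ℝ)) (aeSupport μ ((g : Lp ℝ 2 μ) : X → ℝ)) →
    𝓔.form f g = 0

/-- `𝓔` is regular: with `C₀(X)` the continuous functions of compact support, `domain ∩ C₀(X)` is
dense in the domain for the norm `(𝓔(f, f) + ‖f‖²)^{1/2}`, and dense in `C₀(X)` for the uniform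
norm. -/
def DirichletForm.IsRegular (𝓔 : DirichletForm μ) : Prop :=
  (∀ f : 𝓔.domain, ∀ ε > 0, ∃ g : 𝓔.domain,
    (∃ φ : X → ℝ, Continuous φ ∧ HasCompactSupport φ ∧
      ((g : Lp ℝ 2 μ) : X → ℝ) =ᵐ[μ] φ) ∧
    𝓔.form (f - g) (f - g) + ‖((f - g : 𝓔.domain) : Lp ℝ 2 μ)‖ ^ 2 < ε) ∧
  (∀ φ : X → ℝ, Continuous φ → HasCompactSupport φ → ∀ ε > 0,
    ∃ ψ : X → ℝ, Continuous ψ ∧ HasCompactSupport ψ ∧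
      (∃ g : 𝓔.domain, ((g : Lp ℝ 2 μ) : X → ℝ) =ᵐ[μ] ψ) ∧ ∀ x, |φ x - ψ x| < ε)

end DirichletForms

namespace Hanoi

/-! ### The Hanoi attractor -/

/-- The Euclidean plane. -/
abbrev Plane : Type := EuclideanSpace ℝ (Fin 2)

/-- The points `p₁, …, p₆` (indexed here from `0` to `5`): the vertices of an equilateral triangle
of side length `1` and the midpoints of the opposite sides. -/
def p : Fin 6 → Plane :=
  ![!₂[0, 0], !₂[1 / 2, √3 / 2], !₂[1, 0], !₂[3 / 4, √3 / 4], !₂[1 / 2, 0], !₂[1 / 4, √3 / 4]]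

/-- The matrices `A₁, …, A₆`. -/
def A (α : ℝ) : Fin 6 → Matrix (Fin 2) (Fin 2) ℝ :=
  ![((1 - α) / 2) • 1, ((1 - α) / 2) • 1, ((1 - α) / 2) • 1,
    (α / 4) • !![1, -√3; -√3, 3], α • !![1, 0; 0, 0], (α / 4) • !![1, √3; √3, 3]]

/-- The maps `G_{α,i}(x) = A_i (x - p_i) + p_i`. -/
def G (α : ℝ) (i : Fin 6) (x : Plane) : Plane :=
  Matrix.toEuclideanLin (A α i) (x - p i) + p i

/-- `K` is a nonempty compact set with `K = ⋃ᵢ G_{α,i}(K)`. -/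
def IsAttractor (α : ℝ) (K : Set Plane) : Prop :=
  K.Nonempty ∧ IsCompact K ∧ K = ⋃ i, G α i '' K

lemma sqrt3_sq : √(3 : ℝ) ^ 2 = 3 := Real.sq_sqrt (by norm_num)

lemma norm_A_le {α : ℝ} (h0 : 0 < α) (h1 : α < 1 / 3) (i : Fin 6) (v : Plane) :
    ‖Matrix.toEuclideanLin (A α i) v‖ ≤ ((1 - α) / 2) * ‖v‖ := by
  have h3 := sqrt3_sq
  have hc : 0 ≤ (1 - α) / 2 := by linarith
  have hs : α ^ 2 ≤ ((1 - α) / 2) ^ 2 := by nlinarith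
  have hv : α ^ 2 * (v 0 ^ 2 + v 1 ^ 2) ≤ ((1 - α) / 2) ^ 2 * (v 0 ^ 2 + v 1 ^ 2) :=
    mul_le_mul_of_nonneg_right hs (by positivity)
  refine abs_le_of_sq_le_sq' ?_ (by positivity) |>.2
  rw [mul_pow, EuclideanSpace.norm_sq_eq, EuclideanSpace.norm_sq_eq]
  simp only [Fin.sum_univ_two, Real.norm_eq_abs, sq_abs]
  fin_cases i <;>
    simp [A, Matrix.toLpLin_apply, dotProduct, Fin.sum_univ_two]
  · nlinarith
  · nlinarith
  · nlinarith
  · have : (α / 4 * v 0 + -(α / 4 * √3 * v 1)) ^ 2 + (-(α / 4 * √3 * v 0) + α / 4 * 3 * v 1) ^ 2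
        = α ^ 2 * (v 0 ^ 2 + v 1 ^ 2) - (α / 4) ^ 2 * 4 * (√3 * v 0 + v 1) ^ 2 := by
      grind
    nlinarith [sq_nonneg ((α / 4) * 2 * (√3 * v 0 + v 1))]
  · nlinarith [sq_nonneg (α * v 1)]
  · have : (α / 4 * v 0 + α / 4 * √3 * v 1) ^ 2 + (α / 4 * √3 * v 0 + α / 4 * 3 * v 1) ^ 2
        = α ^ 2 * (v 0 ^ 2 + v 1 ^ 2) - (α / 4) ^ 2 * 4 * (√3 * v 0 - v 1) ^ 2 := by
      grind
    nlinarith [sq_nonneg ((α / 4) * 2 * (√3 * v 0 - v 1))]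

lemma dist_G_le {α : ℝ} (h0 : 0 < α) (h1 : α < 1 / 3) (i : Fin 6) (x y : Plane) :
    dist (G α i x) (G α i y) ≤ ((1 - α) / 2) * dist x y := by
  have : G α i x - G α i y = Matrix.toEuclideanLin (A α i) (x - y) := by
    simp only [G, map_sub]; abel
  rw [dist_eq_norm, dist_eq_norm, this]
  exact norm_A_le h0 h1 i _

/-- For `0 < α < 1/3` there is exactly one nonempty compact `K` with `K = ⋃ᵢ G_{α,i}(K)`. -/
theorem existsUnique_isAttractor {α : ℝ} (h0 : 0 < α) (h1 : α < 1 / 3) :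
    ∃! K : Set Plane, IsAttractor α K := by
  classical
  set c : NNReal := ⟨(1 - α) / 2, by linarith⟩ with hc
  have hL : ∀ i, LipschitzWith c (G α i) := fun i =>
    LipschitzWith.of_dist_le_mul fun x y => dist_G_le h0 h1 i x y
  let T : TopologicalSpace.NonemptyCompacts Plane → TopologicalSpace.NonemptyCompacts Plane :=
    fun K => ⟨⟨⋃ i, G α i '' (K : Set Plane),
      isCompact_iUnion fun i => K.isCompact.image (hL i).continuous⟩,
      Set.nonempty_iUnion.2 ⟨0, K.nonempty.image _⟩⟩
  have hT : ContractingWith c T := by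
    refine ⟨?_, fun K L => ?_⟩
    · rw [← NNReal.coe_lt_coe]
      change (1 - α) / 2 < 1
      linarith
    · change Metric.hausdorffEDist (⋃ i, G α i '' (K : Set Plane)) (⋃ i, G α i '' (L : Set Plane))
        ≤ c * Metric.hausdorffEDist (K : Set Plane) L
      refine Metric.hausdorffEDist_iUnion_le.trans (iSup_le fun i => ?_)
      have key : ∀ S R : TopologicalSpace.NonemptyCompacts Plane, ∀ x ∈ G α i '' (S : Set Plane),
          ∃ y ∈ G α i '' (R : Set Plane),
            edist x y ≤ c * Metric.hausdorffEDist (S : Set Plane) R := by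
        rintro S R _ ⟨x, hx, rfl⟩
        obtain ⟨y, hy, hxy⟩ := R.isCompact.exists_infEDist_eq_edist R.nonempty x
        refine ⟨G α i y, ⟨y, hy, rfl⟩, (hL i x y).trans ?_⟩
        gcongr
        rw [← hxy]
        exact Metric.infEDist_le_hausdorffEDist_of_mem hx
      refine Metric.hausdorffEDist_le_of_mem_edist (key K L) ?_
      rw [Metric.hausdorffEDist_comm (s := (K : Set Plane))]
      exact key L K
  have : Nonempty (TopologicalSpace.NonemptyCompacts Plane) := ⟨⟨⟨{0}, isCompact_singleton⟩, by simp⟩⟩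
  set K₀ : TopologicalSpace.NonemptyCompacts Plane := ContractingWith.fixedPoint T hT with hK₀
  have hfix : T K₀ = K₀ := hT.fixedPoint_isFixedPt
  refine ⟨(K₀ : Set Plane), ⟨K₀.nonempty, K₀.isCompact,
    (congrArg (fun K : TopologicalSpace.NonemptyCompacts Plane => (K : Set Plane)) hfix).symm⟩, ?_⟩
  rintro K ⟨hn, hcpt, hK⟩
  have : Function.IsFixedPt T ⟨⟨K, hcpt⟩, hn⟩ :=
    TopologicalSpace.NonemptyCompacts.ext hK.symm
  exact congrArg (fun K : TopologicalSpace.NonemptyCompacts Plane => (K : Set Plane))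
    (hT.fixedPoint_unique this)

open Classical in
/-- The Hanoi attractor `K_α`: the unique nonempty compact `K` with `K = ⋃ᵢ G_{α,i}(K)`. -/
def attractor (α : ℝ) : Set Plane :=
  if h : ∃ K : Set Plane, IsAttractor α K then h.choose else ∅

theorem isAttractor_attractor {α : ℝ} (h0 : 0 < α) (h1 : α < 1 / 3) :
    IsAttractor α (attractor α) := by
  have h := (existsUnique_isAttractor h0 h1).exists
  rw [attractor, dif_pos h]
  exact h.choose_spec

/-! ### The approximating sets: cells and connecting segments -/

/-- The letters `1, 2, 3` of the alphabet, among the six indices. -/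
def letter (i : Fin 3) : Fin 6 := Fin.castLE (by norm_num) i

/-- `G_w = G_{w₁} ∘ ⋯ ∘ G_{wₙ}` for a word `w` of length `n` over the alphabet of three letters. -/
def cellMap (α : ℝ) : (n : ℕ) → (Fin n → Fin 3) → Plane → Plane
  | 0, _ => id
  | n + 1, w => G α (letter (w 0)) ∘ cellMap α n (Fin.tail w)

/-- The vertex `G_w(p_i)`, `i ∈ {1, 2, 3}`. -/
def vertex (α : ℝ) {n : ℕ} (w : Fin n → Fin 3) (i : Fin 3) : Plane :=
  cellMap α n w (p (letter i))

/-- The parametrization `t ↦ (b_e - a_e) t + a_e`, `t ∈ [0, 1]`, of the segment `e = G_w(e_i)` that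
joins `a_e = G_w(G_j(p_k))` to `b_e = G_w(G_k(p_j))`, where `{i, j, k} = {1, 2, 3}` (here
`j = i + 1` and `k = i + 2` modulo `3`). For the words `w` of length `n - 1` these are the
connected components of `J_n` that do not belong to `J_{n-1}`. -/
def segment (α : ℝ) {n : ℕ} (w : Fin n → Fin 3) (i : Fin 3) (t : ℝ) : Plane :=
  let a := cellMap α n w (G α (letter (i + 1)) (p (letter (i + 2))))
  let b := cellMap α n w (G α (letter (i + 2)) (p (letter (i + 1))))
  t • (b - a) + a

/-- A function on `K_α`, read as a function on the plane (by zero off `K_α`), so that it can be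
evaluated at vertices and along segments, which lie in `K_α`. -/
def ext {α : ℝ} (u : attractor α → ℝ) : Plane → ℝ :=
  Function.extend Subtype.val u 0

/-- The restriction of `u` to the segment `G_w(e_i)`, in the parameter `t ∈ [0, 1]`. -/
def onSegment {α : ℝ} (u : attractor α → ℝ) {n : ℕ} (w : Fin n → Fin 3) (i : Fin 3) : ℝ → ℝ :=
  fun t => ext u (segment α w i t)

/-- The Sobolev space `H¹(0, 1)`, in terms of continuous representatives on `[0, 1]`: the
absolutely continuous functions whose derivative is square integrable. -/
def MemH1 (f : ℝ → ℝ) : Prop :=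
  AbsolutelyContinuousOnInterval f 0 1 ∧ MemLp (deriv f) 2 (volume.restrict (Set.Ioc 0 1))

/-! ### The energy -/

/-- `d₀ = 0` and `dₙ = α ((1 - α) / 2)^{n - 1}` for `n ≥ 1`. -/
def d (α : ℝ) : ℕ → ℝ
  | 0 => 0
  | n + 1 => α * ((1 - α) / 2) ^ n

/-- `r^d_n = 3 / (5 + 3 dₙ)`. -/
def rD (α : ℝ) (n : ℕ) : ℝ := 3 / (5 + 3 * d α n)

/-- `r^c_n = 3 dₙ / (5 + 3 dₙ)`. -/
def rC (α : ℝ) (n : ℕ) : ℝ := 3 * d α n / (5 + 3 * d α n)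

/-- `ρ^d_n = ∏_{i = 1}^n r^d_i`. -/
def rhoD (α : ℝ) (n : ℕ) : ℝ := ∏ i ∈ Finset.range n, rD α (i + 1)

/-- `ρ^c_n = ρ^d_{n-1} r^c_n` (used for `n ≥ 1`). -/
def rhoC (α : ℝ) (n : ℕ) : ℝ := rhoD α (n - 1) * rC α n

/-- The discrete energy `E^d_n[u] = ∑_{x ∼ y} (u(x) - u(y))²` over the unordered pairs of
`n`-neighbours, that is over the three sides of each cell `G_w({p₁, p₂, p₃})`, `|w| = n`. -/
def discreteEnergy {α : ℝ} (n : ℕ) (u : attractor α → ℝ) : ℝ :=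
  ∑ w : Fin n → Fin 3, ∑ i : Fin 3,
    (ext u (vertex α w (i + 1)) - ext u (vertex α w (i + 2))) ^ 2

/-- `∑_e ∫₀¹ |(u ∘ φ_e)'|² dt` over the segments `e = G_w(e_i)` with `|w| = k`, that is over the
components of `J_{k+1}` not in `J_k`. -/
def segmentEnergy {α : ℝ} (k : ℕ) (u : attractor α → ℝ) : ℝ :=
  ∑ w : Fin k → Fin 3, ∑ i : Fin 3, ∫ t in (0 : ℝ)..1, (deriv (onSegment u w i) t) ^ 2

/-- The renormalized energy at level `n`,
`𝓔_n[u] = (ρ^d_n)⁻¹ E^d_n[u] + ∑_{k = 1}^n (ρ^c_k)⁻¹ ∑_{e ∈ 𝒥_k \ 𝒥_{k-1}} ∫₀¹ |(u ∘ φ_e)'|² dt`. -/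
def levelEnergy {α : ℝ} (n : ℕ) (u : attractor α → ℝ) : ℝ :=
  (rhoD α n)⁻¹ * discreteEnergy n u +
    ∑ k ∈ Finset.range n, (rhoC α (k + 1))⁻¹ * segmentEnergy k u

/-- The space `𝓕` of continuous functions on `K_α` which are `H¹` on every segment and for which
`lim 𝓔_n[u]` exists in `ℝ`. -/
def F (α : ℝ) : Set (attractor α → ℝ) :=
  {u | Continuous u ∧ (∀ (n : ℕ) (w : Fin n → Fin 3) (i : Fin 3), MemH1 (onSegment u w i)) ∧
    ∃ l : ℝ, Tendsto (fun n => levelEnergy n u) atTop (𝓝 l)}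

/-- `𝓔[u] = lim 𝓔_n[u]`. -/
def energy {α : ℝ} (u : attractor α → ℝ) : ℝ :=
  limUnder atTop (fun n => levelEnergy n u)

/-- `𝓔(u, v)`, by polarization. -/
def energyForm {α : ℝ} (u v : attractor α → ℝ) : ℝ :=
  (energy (u + v) - energy u - energy v) / 2

/-! ### The induced Dirichlet form -/

/-- The closure of `C₀(K_α) ∩ 𝓕` in `𝓕` with respect to the norm
`(𝓔(u, u) + ∫ u² dμ)^{1/2}`. -/
def inducedDomain (α : ℝ) (μ : Measure (attractor α)) : Set (attractor α → ℝ) :=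
  {u | u ∈ F α ∧ ∀ ε > 0, ∃ v ∈ F α, Continuous v ∧ HasCompactSupport v ∧
    energyForm (u - v) (u - v) + ∫ x, ((u - v) x) ^ 2 ∂μ < ε}

/-- `𝓓` is the form on `L²(K_α, μ)` that consists of the classes of the functions in the induced
domain, with `𝓓([u], [v]) = 𝓔(u, v)`. -/
def IsInducedForm {α : ℝ} {μ : Measure (attractor α)} (𝓓 : DirichletForm μ) : Prop :=
  (∀ f : Lp ℝ 2 μ, f ∈ 𝓓.domain ↔
    ∃ u ∈ inducedDomain α μ, (f : attractor α → ℝ) =ᵐ[μ] u) ∧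
  (∀ f g : 𝓓.domain, ∀ u ∈ inducedDomain α μ, ∀ v ∈ inducedDomain α μ,
    ((f : Lp ℝ 2 μ) : attractor α → ℝ) =ᵐ[μ] u → ((g : Lp ℝ 2 μ) : attractor α → ℝ) =ᵐ[μ] v →
      𝓓.form f g = energyForm u v)

end Hanoi

end

noncomputable section

namespace Hanoi

/-! ### The Sobolev space on the unit interval -/

/-! The weights `rhoD` and `rhoC` come from electrical network reduction. A triangle subdivided into
three triangles joined by three wires carries, suitably weighted, at least the energy seen at its
three outer corners. On each wire, Cauchy–Schwarz bounds the squared increment by the Dirichlet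
integral. Hence `levelEnergy n u` increases with `n` (`levelEnergy_le_succ`), membership in 𝓕 is
boundedness of the level energies, and bilinearity, non-negativity and contraction properties pass
from finite levels to the limit.

The second pillar is a uniform bound. Since `rhoD α n` decays geometrically, the increments along a
chain of nested cells form a convergent geometric series, so the oscillation of `u` is at most a
constant times `√(energy u)` (`abs_sub_le_sqrt_energy`). The energy norm therefore dominates the
uniform norm (`exists_sq_le`). A Cauchy sequence converges uniformly to a continuous function, which
has finite energy by completeness of `H¹` on each segment and a limit argument over levels
(`mem_F_of_cauchy`).

For density, a Lipschitz function constant on the cells of some level has finite energy, such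
functions separate points, and 𝓕 is a vector lattice, so the lattice form of Stone–Weierstrass
applies (`exists_mem_F_near`). Locality holds because small cells cannot meet two disjoint compact
supports. Compactness of the attractor makes all supports compact, and full support of the measure
makes the continuous representative of a class unique, so the energy is well defined on classes. -/

lemma ae_unit_of_uIcc {P : ℝ → Prop} (h : ∀ᵐ x, x ∈ Set.uIcc (0 : ℝ) 1 → P x) :
    ∀ᵐ x ∂(volume.restrict (Set.Ioc (0 : ℝ) 1)), P x := by
  rw [ae_restrict_iff' measurableSet_Ioc]
  filter_upwards [h] with x hx hx'
  exact hx (by rw [Set.uIcc_of_le zero_le_one]; exact Set.Ioc_subset_Icc_self hx')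

lemma ae_unit_of_Ioo {P : ℝ → Prop} (h : ∀ x ∈ Set.Ioo (0 : ℝ) 1, P x) :
    ∀ᵐ x ∂(volume.restrict (Set.Ioc (0 : ℝ) 1)), P x := by
  rw [← restrict_Ioo_eq_restrict_Ioc, ae_restrict_iff' measurableSet_Ioo]
  exact Eventually.of_forall h

namespace MemH1

variable {f g : ℝ → ℝ}

lemma ae_differentiableAt (hf : MemH1 f) :
    ∀ᵐ x ∂(volume.restrict (Set.Ioc (0 : ℝ) 1)), DifferentiableAt ℝ f x :=
  ae_unit_of_uIcc hf.1.ae_differentiableAt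

lemma deriv_add_ae (hf : MemH1 f) (hg : MemH1 g) :
    deriv (f + g) =ᵐ[volume.restrict (Set.Ioc (0 : ℝ) 1)] deriv f + deriv g := by
  filter_upwards [hf.ae_differentiableAt, hg.ae_differentiableAt] with x h1 h2
  exact deriv_add h1 h2

lemma deriv_sub_ae (hf : MemH1 f) (hg : MemH1 g) :
    deriv (f - g) =ᵐ[volume.restrict (Set.Ioc (0 : ℝ) 1)] deriv f - deriv g := by
  filter_upwards [hf.ae_differentiableAt, hg.ae_differentiableAt] with x h1 h2
  exact deriv_sub h1 h2

lemma deriv_smul_ae (c : ℝ) (f : ℝ → ℝ) :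
    deriv (c • f) =ᵐ[volume.restrict (Set.Ioc (0 : ℝ) 1)] c • deriv f := by
  refine Eventually.of_forall fun x => ?_
  change deriv (fun y => c * f y) x = c * deriv f x
  rw [deriv_const_mul_field]

lemma add (hf : MemH1 f) (hg : MemH1 g) : MemH1 (f + g) :=
  ⟨hf.1.add hg.1, (memLp_congr_ae (hf.deriv_add_ae hg)).2 (hf.2.add hg.2)⟩

lemma sub (hf : MemH1 f) (hg : MemH1 g) : MemH1 (f - g) :=
  ⟨hf.1.sub hg.1, (memLp_congr_ae (hf.deriv_sub_ae hg)).2 (hf.2.sub hg.2)⟩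

lemma smul (c : ℝ) (hf : MemH1 f) : MemH1 (c • f) :=
  ⟨hf.1.const_mul c, (memLp_congr_ae (deriv_smul_ae c f)).2 (hf.2.const_smul c)⟩

end MemH1

/-- A normal contraction does not increase the modulus of the derivative. -/
lemma abs_deriv_comp_le {f ψ : ℝ → ℝ} (hψ : ∀ s t, |ψ s - ψ t| ≤ |s - t|) {x : ℝ}
    (hf : DifferentiableAt ℝ f x) : |deriv (ψ ∘ f) x| ≤ |deriv f x| := by
  by_cases h : DifferentiableAt ℝ (ψ ∘ f) x
  · refine le_of_tendsto_of_tendsto (hasDerivAt_iff_tendsto_slope.1 h.hasDerivAt).abs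
      (hasDerivAt_iff_tendsto_slope.1 hf.hasDerivAt).abs (Eventually.of_forall fun y => ?_)
    simp only [slope_def_field, abs_div, Function.comp]
    exact div_le_div_of_nonneg_right (hψ _ _) (abs_nonneg _)
  · rw [deriv_zero_of_not_differentiableAt h]; simp

lemma MemH1.comp {f ψ : ℝ → ℝ} (hψ : ∀ s t, |ψ s - ψ t| ≤ |s - t|) (hf : MemH1 f) :
    MemH1 (ψ ∘ f) := by
  refine ⟨?_, ?_⟩
  · refine squeeze_zero (fun t => Finset.sum_nonneg fun i _ => dist_nonneg) (fun t => ?_) hf.1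
    exact Finset.sum_le_sum fun i _ => hψ _ _
  · refine hf.2.mono (measurable_deriv _).aestronglyMeasurable ?_
    filter_upwards [hf.ae_differentiableAt] with x hx
    exact abs_deriv_comp_le hψ hx

lemma memH1_of_dist_le {f : ℝ → ℝ} {C : ℝ}
    (hf : ∀ s ∈ Set.Icc (0 : ℝ) 1, ∀ t ∈ Set.Icc (0 : ℝ) 1, |f s - f t| ≤ C * |s - t|) :
    MemH1 f := by
  have hL : LipschitzOnWith C.toNNReal f (Set.Icc 0 1) := by
    refine LipschitzOnWith.of_dist_le_mul fun s hs t ht => (hf s hs t ht).trans ?_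
    exact mul_le_mul_of_nonneg_right (Real.le_coe_toNNReal C) (abs_nonneg _)
  refine ⟨LipschitzOnWith.absolutelyContinuousOnInterval (K := C.toNNReal)
    (by rwa [Set.uIcc_of_le zero_le_one]), ?_⟩
  refine MemLp.of_bound (measurable_deriv _).aestronglyMeasurable C.toNNReal (ae_unit_of_Ioo ?_)
  intro x hx
  exact norm_deriv_le_of_lipschitzOn (Icc_mem_nhds hx.1 hx.2) hL

lemma MemH1.mul_integrable {f g : ℝ → ℝ} (hf : MemH1 f) (hg : MemH1 g) :
    IntervalIntegrable (fun t => deriv f t * deriv g t) volume 0 1 := by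
  rw [intervalIntegrable_iff_integrableOn_Ioc_of_le zero_le_one]
  exact hf.2.integrable_mul hg.2

lemma MemH1.sq_integrable {f : ℝ → ℝ} (hf : MemH1 f) :
    IntervalIntegrable (fun t => deriv f t ^ 2) volume 0 1 := by
  simpa only [sq] using hf.mul_integrable hf

/-- The Dirichlet inner product on the unit interval. -/
def h1Inner (f g : ℝ → ℝ) : ℝ := ∫ t in (0 : ℝ)..1, deriv f t * deriv g t

lemma h1Inner_comm (f g : ℝ → ℝ) : h1Inner f g = h1Inner g f := by
  simp only [h1Inner, mul_comm]

lemma h1Inner_self (f : ℝ → ℝ) : h1Inner f f = ∫ t in (0 : ℝ)..1, deriv f t ^ 2 := by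
  simp only [h1Inner, sq]

lemma h1Inner_self_nonneg (f : ℝ → ℝ) : 0 ≤ h1Inner f f :=
  intervalIntegral.integral_nonneg zero_le_one fun _ _ => mul_self_nonneg _

/-- Only the products of derivatives are compared: in the locality argument one factor vanishes near
each parameter, but which one depends on the parameter. -/
lemma h1Inner_congr {f g f' g' : ℝ → ℝ}
    (h : ∀ᵐ t ∂(volume.restrict (Set.Ioc (0 : ℝ) 1)),
      deriv f t * deriv g t = deriv f' t * deriv g' t) : h1Inner f g = h1Inner f' g' := by
  rw [h1Inner, h1Inner, intervalIntegral.integral_of_le zero_le_one,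
    intervalIntegral.integral_of_le zero_le_one]
  exact integral_congr_ae h

lemma h1Inner_add_left {f g h : ℝ → ℝ} (hf : MemH1 f) (hg : MemH1 g) (hh : MemH1 h) :
    h1Inner (f + g) h = h1Inner f h + h1Inner g h := by
  unfold h1Inner
  rw [← intervalIntegral.integral_add (hf.mul_integrable hh) (hg.mul_integrable hh),
    intervalIntegral.integral_of_le zero_le_one, intervalIntegral.integral_of_le zero_le_one]
  refine integral_congr_ae ?_
  filter_upwards [hf.deriv_add_ae hg] with x hx
  rw [hx, Pi.add_apply, add_mul]

lemma h1Inner_smul_left (c : ℝ) (f h : ℝ → ℝ) : h1Inner (c • f) h = c * h1Inner f h := by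
  unfold h1Inner
  rw [← intervalIntegral.integral_const_mul,
    intervalIntegral.integral_of_le zero_le_one, intervalIntegral.integral_of_le zero_le_one]
  refine integral_congr_ae ?_
  filter_upwards [MemH1.deriv_smul_ae c f] with x hx
  rw [hx, Pi.smul_apply, smul_eq_mul, mul_assoc]

lemma h1Inner_comp_le {f ψ : ℝ → ℝ} (hψ : ∀ s t, |ψ s - ψ t| ≤ |s - t|) (hf : MemH1 f) :
    h1Inner (ψ ∘ f) (ψ ∘ f) ≤ h1Inner f f := by
  rw [h1Inner_self, h1Inner_self, intervalIntegral.integral_of_le zero_le_one,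
    intervalIntegral.integral_of_le zero_le_one]
  refine integral_mono_ae ?_ ?_ ?_
  · exact (hf.comp hψ).2.integrable_sq
  · exact hf.2.integrable_sq
  · filter_upwards [hf.ae_differentiableAt] with x hx
    exact sq_le_sq.2 (abs_deriv_comp_le hψ hx)

/-- The Cauchy-Schwarz bound for the increments of an `H¹` function. -/
lemma MemH1.sq_sub_le {f : ℝ → ℝ} (hf : MemH1 f) {s t : ℝ} (hs : 0 ≤ s) (hst : s ≤ t)
    (ht : t ≤ 1) : (f t - f s) ^ 2 ≤ h1Inner f f := by
  have hsub : Set.uIcc s t ⊆ Set.uIcc (0 : ℝ) 1 := by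
    rw [Set.uIcc_of_le hst, Set.uIcc_of_le zero_le_one]; exact Set.Icc_subset_Icc hs ht
  have hFT := (hf.1.mono hsub).integral_deriv_eq_sub
  have hi1 : IntervalIntegrable (deriv f) volume s t := (hf.1.mono hsub).intervalIntegrable_deriv
  have hi2 : IntervalIntegrable (fun x => deriv f x ^ 2) volume s t :=
    hf.sq_integrable.mono_set hsub
  -- Expanding the non-negative integral of `(f' - c) ^ 2` gives a quadratic lower bound in `c`. The
  -- choice `c = f t - f s` then suffices because `t - s ≤ 1`.
  have key : ∀ c : ℝ, 2 * c * (f t - f s) - c ^ 2 * (t - s) ≤ h1Inner f f := by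
    intro c
    have h1 : 0 ≤ ∫ x in s..t, (deriv f x - c) ^ 2 :=
      intervalIntegral.integral_nonneg hst fun _ _ => sq_nonneg _
    have h2 : ∫ x in s..t, (deriv f x - c) ^ 2 =
        (∫ x in s..t, deriv f x ^ 2) - 2 * c * (f t - f s) + c ^ 2 * (t - s) := by
      have : ∀ x, (deriv f x - c) ^ 2 = deriv f x ^ 2 - (2 * c * deriv f x - c ^ 2) :=
        fun x => by ring
      simp only [this]
      rw [intervalIntegral.integral_sub hi2 ((hi1.const_mul _).sub intervalIntegrable_const),
        intervalIntegral.integral_sub (hi1.const_mul _) intervalIntegrable_const,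
        intervalIntegral.integral_const_mul, hFT, intervalIntegral.integral_const, smul_eq_mul]
      ring
    have h3 : ∫ x in s..t, deriv f x ^ 2 ≤ ∫ x in (0 : ℝ)..1, deriv f x ^ 2 :=
      intervalIntegral.integral_mono_interval hs hst ht
        (Eventually.of_forall fun _ => sq_nonneg _) hf.sq_integrable
    rw [h1Inner_self]
    linarith
  have := key (f t - f s)
  nlinarith [sq_nonneg (f t - f s)]

lemma norm_toLp_sq {X : Type*} [MeasurableSpace X] {f : X → ℝ} {ν : Measure X} (hf : MemLp f 2 ν) :
    ‖hf.toLp‖ ^ 2 = ∫ x, f x ^ 2 ∂ν := by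
  rw [← real_inner_self_eq_norm_sq, L2.inner_def]
  refine integral_congr_ae ?_
  filter_upwards [hf.coeFn_toLp] with x hx
  rw [hx]; simp [sq]

/-- `H¹(0, 1)` is complete. -/
lemma memH1_of_cauchy {f : ℕ → ℝ → ℝ} {f₀ : ℝ → ℝ} (hf : ∀ m, MemH1 (f m))
    (hlim : ∀ t ∈ Set.Icc (0 : ℝ) 1, Tendsto (fun m => f m t) atTop (𝓝 (f₀ t)))
    (hC : ∀ ε > 0, ∃ N, ∀ m ≥ N, ∀ n ≥ N, h1Inner (f m - f n) (f m - f n) < ε) :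
    MemH1 f₀ ∧ Tendsto (fun m => h1Inner (f₀ - f m) (f₀ - f m)) atTop (𝓝 0) := by
  set ν := volume.restrict (Set.Ioc (0 : ℝ) 1) with hν
  have hdist : ∀ {a b : ℝ → ℝ} (ha : MemLp a 2 ν) (hb : MemLp b 2 ν),
      dist ha.toLp hb.toLp ^ 2 = ∫ x, (a x - b x) ^ 2 ∂ν := by
    intro a b ha hb
    rw [dist_eq_norm, ← MemLp.toLp_sub, norm_toLp_sq]
    rfl
  have hinner : ∀ {a b : ℝ → ℝ}, MemH1 a → MemH1 b →
      h1Inner (a - b) (a - b) = ∫ x, (deriv a x - deriv b x) ^ 2 ∂ν := by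
    intro a b ha hb
    rw [h1Inner_self, intervalIntegral.integral_of_le zero_le_one]
    refine integral_congr_ae ?_
    filter_upwards [ha.deriv_sub_ae hb] with x hx
    rw [hx]; rfl
  have hcau : CauchySeq fun m => (hf m).2.toLp := by
    rw [Metric.cauchySeq_iff]
    intro ε hε
    obtain ⟨N, hN⟩ := hC (ε ^ 2) (by positivity)
    refine ⟨N, fun m hm n hn => ?_⟩
    have := hN m hm n hn
    rw [hinner (hf m) (hf n), ← hdist (hf m).2 (hf n).2] at this
    exact lt_of_pow_lt_pow_left₀ 2 hε.le this
  obtain ⟨g, hg⟩ := cauchySeq_tendsto_of_complete hcau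
  have hgL : MemLp g 2 ν := Lp.memLp g
  have hgi : IntegrableOn g (Set.Ioc 0 1) := hgL.integrable (by norm_num)
  have hgI : IntervalIntegrable g volume 0 1 :=
    (intervalIntegrable_iff_integrableOn_Ioc_of_le zero_le_one).2 hgi
  have hsq : Tendsto (fun m => ∫ x, (deriv (f m) x - g x) ^ 2 ∂ν) atTop (𝓝 0) := by
    have h := (tendsto_iff_dist_tendsto_zero.1 hg).pow 2
    rw [zero_pow (by norm_num)] at h
    refine h.congr fun m => ?_
    rw [← hdist (hf m).2 hgL, Lp.toLp_coeFn]
  have hint : ∀ t ∈ Set.Icc (0 : ℝ) 1,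
      Tendsto (fun m => ∫ x in (0 : ℝ)..t, deriv (f m) x) atTop (𝓝 (∫ x in (0 : ℝ)..t, g x)) := by
    intro t ht
    -- On the unit interval, a probability space, `L²` convergence of the derivatives implies `L¹`
    -- convergence, hence convergence of their integrals over `(0, t]`.
    have h1 : Tendsto (fun m => eLpNorm (deriv (f m) - (g : ℝ → ℝ)) 1 (volume.restrict (Set.Ioc 0 t)))
        atTop (𝓝 0) := by
      have h2 : Tendsto (fun m => eLpNorm (deriv (f m) - (g : ℝ → ℝ)) 2 ν) atTop (𝓝 0) := by
        have := (Lp.tendsto_Lp_iff_tendsto_eLpNorm' _ g).1 hg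
        refine this.congr fun m => eLpNorm_congr_ae ?_
        filter_upwards [(hf m).2.coeFn_toLp] with x hx
        simp [hx]
      refine tendsto_of_tendsto_of_tendsto_of_le_of_le tendsto_const_nhds h2
        (fun _ => zero_le) fun m => ?_
      refine (eLpNorm_mono_measure _ (Measure.restrict_mono_set _
        (Set.Ioc_subset_Ioc_right ht.2))).trans ?_
      have : IsProbabilityMeasure ν := ⟨by simp [hν]⟩
      exact eLpNorm_le_eLpNorm_of_exponent_le (by norm_num)
        ((hf m).2.1.sub hgL.1)
    have h3 := tendsto_setIntegral_of_L1' (μ := volume.restrict (Set.Ioc 0 t)) g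
      (hgi.mono_set (Set.Ioc_subset_Ioc_right ht.2)).aestronglyMeasurable
      (Eventually.of_forall fun m => ((hf m).2.integrable (by norm_num)).mono_measure
        (Measure.restrict_mono_set _ (Set.Ioc_subset_Ioc_right ht.2))) h1 Set.univ
    simpa [intervalIntegral.integral_of_le ht.1] using h3
  -- Passing to the limit in the fundamental theorem of calculus makes `f₀` a primitive of `g`.
  -- Absolute continuity and the derivative of `f₀` are read off from this.
  have hrep : ∀ t ∈ Set.Icc (0 : ℝ) 1, f₀ t = f₀ 0 + ∫ x in (0 : ℝ)..t, g x := by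
    intro t ht
    have h1 : Tendsto (fun m => f m t - f m 0) atTop (𝓝 (f₀ t - f₀ 0)) :=
      (hlim t ht).sub (hlim 0 (by simp))
    have h2 := (hint t ht).congr fun m => by
      have hsub : Set.uIcc 0 t ⊆ Set.uIcc (0 : ℝ) 1 := by
        rw [Set.uIcc_of_le ht.1, Set.uIcc_of_le zero_le_one]
        exact Set.Icc_subset_Icc_right ht.2
      exact ((hf m).1.mono hsub).integral_deriv_eq_sub
    linarith [tendsto_nhds_unique h1 h2]
  have hAC : AbsolutelyContinuousOnInterval f₀ 0 1 := by
    have h := hgI.absolutelyContinuousOnInterval_intervalIntegral (c := 0) (by simp)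
    rw [absolutelyContinuousOnInterval_iff] at h ⊢
    intro ε hε
    obtain ⟨δ, hδ, h⟩ := h ε hε
    refine ⟨δ, hδ, fun E hE hlt => ?_⟩
    refine lt_of_le_of_lt (le_of_eq (Finset.sum_congr rfl fun i hi => ?_)) (h E hE hlt)
    have := hE.1 i hi
    rw [Set.uIcc_of_le zero_le_one] at this
    rw [hrep _ this.1, hrep _ this.2, dist_add_left]
  have hder : deriv f₀ =ᵐ[ν] g := by
    have h := hgI.ae_hasDerivAt_integral
    have h' : ∀ᵐ x, x ∈ Set.uIcc (0 : ℝ) 1 → HasDerivAt (fun t => ∫ y in (0 : ℝ)..t, g y) (g x) x := by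
      filter_upwards [h] with x hx hx'
      exact hx hx' 0 (by simp)
    have hIoo : ∀ᵐ x ∂ν, x ∈ Set.Ioo (0 : ℝ) 1 := ae_unit_of_Ioo fun x hx => hx
    filter_upwards [ae_unit_of_uIcc h', hIoo] with x hx hx'
    have : f₀ =ᶠ[𝓝 x] fun t => f₀ 0 + ∫ y in (0 : ℝ)..t, g y := by
      filter_upwards [Ioo_mem_nhds hx'.1 hx'.2] with t ht
      exact hrep t (Set.Ioo_subset_Icc_self ht)
    rw [this.deriv_eq]
    exact (hx.const_add _).deriv
  have hf₀ : MemH1 f₀ := ⟨hAC, (memLp_congr_ae hder).2 hgL⟩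
  refine ⟨hf₀, hsq.congr fun m => ?_⟩
  rw [hinner hf₀ (hf m)]
  refine integral_congr_ae ?_
  filter_upwards [hder] with x hx
  rw [hx]; ring


/-! ### Barycentric coordinates and the maps -/

/-- The barycentric coordinates with respect to the triangle `p₁ p₂ p₃`. -/
def bary (i : Fin 3) (x : Plane) : ℝ :=
  ![1 - x 0 - √3 / 3 * x 1, 2 * √3 / 3 * x 1, x 0 - √3 / 3 * x 1] i

/-- The index of the midpoint of the side opposite to the vertex `p i`. -/
def opp (i : Fin 3) : Fin 6 := ![3, 4, 5] i

/-- The point with parameter `t` on the side opposite to the vertex `p i`. -/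
def side (i : Fin 3) (t : ℝ) : Plane :=
  t • (p (letter (i + 2)) - p (letter (i + 1))) + p (letter (i + 1))

lemma fin_three_cases (k i : Fin 3) : k = i ∨ k = i + 1 ∨ k = i + 2 := by
  revert k i; decide

lemma letter_or_opp (j : Fin 6) : (∃ i, j = letter i) ∨ ∃ i, j = opp i := by
  revert j; decide

lemma continuous_bary (i : Fin 3) : Continuous (bary i) := by
  unfold bary
  fin_cases i <;> simp <;> fun_prop

lemma bary_sum (i : Fin 3) (x : Plane) : bary i x + bary (i + 1) x + bary (i + 2) x = 1 := by
  fin_cases i <;> simp [bary] <;> ring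

lemma G_letter (α : ℝ) (i : Fin 3) (x : Plane) :
    G α (letter i) x = ((1 - α) / 2) • (x - p (letter i)) + p (letter i) := by
  have : A α (letter i) = ((1 - α) / 2) • 1 := by fin_cases i <;> rfl
  rw [G, this]
  simp

lemma bary_G_letter (α : ℝ) (i j : Fin 3) (x : Plane) :
    bary j (G α (letter i) x) =
      (1 - α) / 2 * bary j x + if i = j then 1 - (1 - α) / 2 else 0 := by
  have h3 := sqrt3_sq
  rw [G_letter]
  fin_cases i <;> fin_cases j <;> simp [bary, p, letter] <;> grind

/-- The segment `e i` is the image of the triangle under the projection `G (opp i)`. -/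
lemma G_opp (α : ℝ) (i : Fin 3) (x : Plane) (w : Fin 0 → Fin 3) :
    G α (opp i) x = segment α w i (bary (i + 2) x + bary i x / 2) := by
  -- The linear part of `G α (opp i)` is `α` times the orthogonal projection onto the direction of
  -- the side. Vertex `i` projects to the midpoint, so its weight counts one half.
  have h3 := sqrt3_sq
  simp only [segment, cellMap, id, G_letter]
  ext k
  fin_cases i <;> fin_cases k <;>
    simp [G, opp, A, bary, p, letter, Matrix.toLpLin_apply, Matrix.vecHead,
      Matrix.vecTail] <;> grind

/-- A wire of level zero is the middle piece, of length `α`, left over when the two adjacent corner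
triangles cover the ends of a side. -/
lemma segment_zero_eq_side (α : ℝ) (i : Fin 3) (w : Fin 0 → Fin 3) (t : ℝ) :
    segment α w i t = side i ((1 - α) / 2 + t * α) := by
  simp only [segment, cellMap, id, G_letter, side]
  module

lemma bary_side (i : Fin 3) (t : ℝ) :
    bary i (side i t) = 0 ∧ bary (i + 1) (side i t) = 1 - t ∧ bary (i + 2) (side i t) = t := by
  have h3 := sqrt3_sq
  fin_cases i <;> simp [bary, p, letter, side] <;> grind

lemma dist_G_letter {α : ℝ} (h1 : α < 1) (i : Fin 3) (x y : Plane) :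
    dist (G α (letter i) x) (G α (letter i) y) = (1 - α) / 2 * dist x y := by
  rw [G_letter, G_letter, dist_add_right, dist_smul₀, dist_sub_right, Real.norm_of_nonneg]
  linarith

lemma dist_cellMap {α : ℝ} (h1 : α < 1) (n : ℕ) (w : Fin n → Fin 3) (x y : Plane) :
    dist (cellMap α n w x) (cellMap α n w y) = ((1 - α) / 2) ^ n * dist x y := by
  induction n with
  | zero => simp [cellMap]
  | succ n ih => rw [cellMap, Function.comp, Function.comp, dist_G_letter h1, ih]; ring

lemma continuous_cellMap {α : ℝ} (h1 : α < 1) (n : ℕ) (w : Fin n → Fin 3) :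
    Continuous (cellMap α n w) :=
  (LipschitzWith.of_dist_le_mul (K := (((1 - α) / 2) ^ n).toNNReal) fun x y => by
    rw [dist_cellMap h1]
    exact mul_le_mul_of_nonneg_right (Real.le_coe_toNNReal _) dist_nonneg).continuous

/-- The recursion in `cellMap` peels off the first letter, whereas subdividing a cell appends a last
one. This converts between the two. -/
lemma cellMap_succ (α : ℝ) (n : ℕ) (v : Fin (n + 1) → Fin 3) (x : Plane) :
    cellMap α (n + 1) v x = cellMap α n (Fin.init v) (G α (letter (v (Fin.last n))) x) := by
  induction n generalizing x with
  | zero => rfl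
  | succ n ih =>
    rw [cellMap, Function.comp, ih, cellMap, Function.comp, Fin.tail_init_eq_init_tail]
    rfl

lemma cellMap_snoc (α : ℝ) (n : ℕ) (w : Fin n → Fin 3) (i : Fin 3) (x : Plane) :
    cellMap α (n + 1) (Fin.snoc w i : Fin (n + 1) → Fin 3) x =
      cellMap α n w (G α (letter i) x) := by
  rw [cellMap_succ, Fin.init_snoc, Fin.snoc_last]

lemma cellMap_affine (α : ℝ) (n : ℕ) (w : Fin n → Fin 3) (a b : Plane) (t : ℝ) :
    cellMap α n w (t • (b - a) + a) =
      t • (cellMap α n w b - cellMap α n w a) + cellMap α n w a := by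
  induction n with
  | zero => rfl
  | succ n ih =>
    simp only [cellMap, Function.comp, ih, G_letter]
    module

lemma segment_eq_cellMap (α : ℝ) {n : ℕ} (w : Fin n → Fin 3) (w₀ : Fin 0 → Fin 3) (i : Fin 3)
    (t : ℝ) : segment α w i t = cellMap α n w (segment α w₀ i t) := by
  simp only [segment]
  rw [cellMap_affine]
  rfl

/-- Each corner is the fixed point of its own similarity, so vertices persist at all deeper levels.
-/
lemma vertex_snoc_self (α : ℝ) {n : ℕ} (w : Fin n → Fin 3) (i : Fin 3) :
    vertex α (Fin.snoc w i : Fin (n + 1) → Fin 3) i = vertex α w i := by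
  rw [vertex, cellMap_snoc, G_letter, vertex]
  simp

/-- Wires of level `n` end at vertices of level `n + 1`. This couples the segment energy to the
discrete energy in the renormalization step. -/
lemma segment_start (α : ℝ) {n : ℕ} (w : Fin n → Fin 3) (i : Fin 3) :
    segment α w i 0 = vertex α (Fin.snoc w (i + 1) : Fin (n + 1) → Fin 3) (i + 2) := by
  rw [vertex, cellMap_snoc]; simp [segment]

lemma segment_end (α : ℝ) {n : ℕ} (w : Fin n → Fin 3) (i : Fin 3) :
    segment α w i 1 = vertex α (Fin.snoc w (i + 2) : Fin (n + 1) → Fin 3) (i + 1) := by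
  rw [vertex, cellMap_snoc]; simp [segment]

lemma dist_segment (α : ℝ) {n : ℕ} (w : Fin n → Fin 3) (i : Fin 3) (s t : ℝ) :
    dist (segment α w i s) (segment α w i t) =
      |s - t| * ‖segment α w i 1 - segment α w i 0‖ := by
  simp only [segment, dist_add_right]
  rw [dist_eq_norm, ← sub_smul, norm_smul, Real.norm_eq_abs]
  simp

lemma continuous_segment (α : ℝ) {n : ℕ} (w : Fin n → Fin 3) (i : Fin 3) :
    Continuous (segment α w i) := by
  unfold segment; fun_prop

/-! ### The position of the attractor -/

section

variable {α : ℝ}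

lemma G_mem_attractor (h0 : 0 < α) (h1 : α < 1 / 3) (j : Fin 6) {x : Plane}
    (hx : x ∈ attractor α) : G α j x ∈ attractor α := by
  rw [(isAttractor_attractor h0 h1).2.2]
  exact Set.mem_iUnion.2 ⟨j, x, hx, rfl⟩

lemma isCompact_attractor (h0 : 0 < α) (h1 : α < 1 / 3) : IsCompact (attractor α) :=
  (isAttractor_attractor h0 h1).2.1

lemma cellMap_mem_attractor (h0 : 0 < α) (h1 : α < 1 / 3) (n : ℕ) (w : Fin n → Fin 3)
    {x : Plane} (hx : x ∈ attractor α) : cellMap α n w x ∈ attractor α := by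
  induction n with
  | zero => exact hx
  | succ n ih => exact G_mem_attractor h0 h1 _ (ih _)

/-- A minimum principle: let `m` be the minimum over the attractor of the smallest barycentric
coordinate. If `m < 0`, the minimizing point is an image under some `G α j`, and every such image
has all its coordinates strictly above `m`. -/
lemma bary_nonneg (h0 : 0 < α) (h1 : α < 1 / 3) {x : Plane} (hx : x ∈ attractor α) (i : Fin 3) :
    0 ≤ bary i x := by
  obtain ⟨hne, hc, hK⟩ := isAttractor_attractor h0 h1
  obtain ⟨z, hz, hmin⟩ := hc.exists_isMinOn hne (f := fun x => min (bary 0 x)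
    (min (bary 1 x) (bary 2 x))) (by
      have := continuous_bary
      exact ((this 0).min ((this 1).min (this 2))).continuousOn)
  set m := min (bary 0 z) (min (bary 1 z) (bary 2 z)) with hm
  have hle : ∀ y ∈ attractor α, ∀ j, m ≤ bary j y := by
    intro y hy j
    refine (hmin hy).trans ?_
    fin_cases j <;> simp
  suffices 0 ≤ m from this.trans (hle x hx i)
  by_contra! hneg
  rw [hK] at hz
  obtain ⟨j, y, hy, rfl⟩ := Set.mem_iUnion.1 hz
  have hlt : ∀ k, m < bary k (G α j y) := by
    intro k
    rcases letter_or_opp j with ⟨i, rfl⟩ | ⟨i, rfl⟩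
    · rw [bary_G_letter]
      have := hle y hy k
      split_ifs <;> nlinarith
    · rw [G_opp α i y default, segment_zero_eq_side]
      obtain ⟨e0, e1, e2⟩ := bary_side i ((1 - α) / 2 + (bary (i + 2) y + bary i y / 2) * α)
      have hs := bary_sum i y
      have l0 := hle y hy i
      have l1 := hle y hy (i + 1)
      have l2 := hle y hy (i + 2)
      have hk : k = i ∨ k = i + 1 ∨ k = i + 2 := fin_three_cases k i
      rcases hk with rfl | rfl | rfl
      · rw [e0]; exact hneg
      -- Both remaining coordinates are at least `(1 - α) / 2 + 3 * α * m / 2`, which exceeds `m`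
      -- because `m < 0` and `3 * α / 2 < 1`. The first is rewritten from the other end of the
      -- segment to show this.
      · rw [e1]
        have : bary (i + 2) y + bary i y / 2 = 1 - (bary (i + 1) y + bary i y / 2) := by linarith
        rw [this]
        nlinarith
      · rw [e2]; nlinarith
  exact absurd (hm.symm ▸ lt_min (hlt 0) (lt_min (hlt 1) (hlt 2))) (lt_irrefl m)

lemma bary_le_one (h0 : 0 < α) (h1 : α < 1 / 3) {x : Plane} (hx : x ∈ attractor α) (i : Fin 3) :
    bary i x ≤ 1 := by
  linarith [bary_sum i x, bary_nonneg h0 h1 hx (i + 1), bary_nonneg h0 h1 hx (i + 2)]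

/-- The distance to the attractor attains a maximum on the side. Each point of the side is the image
of a point of the same side under a map that shrinks this distance by `(1 - α) / 2`, so the maximum
is zero. -/
lemma side_mem_attractor (h0 : 0 < α) (h1 : α < 1 / 3) (i : Fin 3) {t : ℝ}
    (ht : t ∈ Set.Icc (0 : ℝ) 1) : side i t ∈ attractor α := by
  obtain ⟨hne, hc, -⟩ := isAttractor_attractor h0 h1
  have hcont : Continuous fun t => Metric.infDist (side i t) (attractor α) := by
    refine (Metric.continuous_infDist_pt _).comp ?_
    unfold side; fun_prop
  obtain ⟨s, hs, hmax⟩ := isCompact_Icc.exists_isMaxOn (Set.nonempty_Icc.2 zero_le_one)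
    hcont.continuousOn
  have hle : ∀ t ∈ Set.Icc (0 : ℝ) 1, Metric.infDist (side i t) (attractor α) ≤
    Metric.infDist (side i s) (attractor α) := fun t ht => hmax ht
  have hG : ∀ j x, Metric.infDist (G α j x) (attractor α) ≤
      (1 - α) / 2 * Metric.infDist x (attractor α) := by
    intro j x
    obtain ⟨y, hy, hxy⟩ := hc.exists_infDist_eq_dist hne x
    rw [hxy]
    exact (Metric.infDist_le_dist_of_mem (G_mem_attractor h0 h1 j hy)).trans (dist_G_le h0 h1 j x y)
  -- The two end pieces are copies under the similarities at the endpoints, and the middle piece is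
  -- a copy under `G α (opp i)`.
  have hs' : ∃ j, ∃ r ∈ Set.Icc (0 : ℝ) 1, side i s = G α j (side i r) := by
    have hcpos : 0 < (1 - α) / 2 := by linarith
    rcases le_total s ((1 - α) / 2) with hle1 | hge1
    · refine ⟨letter (i + 1), s / ((1 - α) / 2),
        ⟨div_nonneg hs.1 hcpos.le, (div_le_one hcpos).2 hle1⟩, ?_⟩
      rw [G_letter, side, side, add_sub_cancel_right, smul_smul, mul_div_cancel₀ _ hcpos.ne']
    · rcases le_total s (1 - (1 - α) / 2) with hle2 | hge2
      · refine ⟨opp i, (s - (1 - α) / 2) / α,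
          ⟨div_nonneg (by linarith) h0.le, (div_le_one h0).2 (by linarith)⟩, ?_⟩
        obtain ⟨e0, e1, e2⟩ := bary_side i ((s - (1 - α) / 2) / α)
        rw [G_opp α i _ default, segment_zero_eq_side, e0, e2]
        congr 1
        field_simp
        ring
      · refine ⟨letter (i + 2), (s - (1 - (1 - α) / 2)) / ((1 - α) / 2),
          ⟨div_nonneg (by linarith) hcpos.le, (div_le_one hcpos).2 (by linarith [hs.2])⟩, ?_⟩
        set r := (s - (1 - (1 - α) / 2)) / ((1 - α) / 2) with hr
        have : s = 1 + (1 - α) / 2 * (r - 1) := by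
          have : (1 - α) / 2 * r = s - (1 - (1 - α) / 2) := mul_div_cancel₀ _ hcpos.ne'
          linarith
        rw [G_letter, this]
        simp only [side]
        module
  have hzero : Metric.infDist (side i s) (attractor α) ≤ 0 := by
    obtain ⟨j, r, hr, he⟩ := hs'
    have h2 := hG j (side i r)
    rw [← he] at h2
    have h3 := hle r hr
    have h4 : 0 ≤ Metric.infDist (side i r) (attractor α) := Metric.infDist_nonneg
    nlinarith
  rw [hc.isClosed.mem_iff_infDist_zero hne]
  exact le_antisymm ((hle t ht).trans hzero) Metric.infDist_nonneg

lemma p_letter_mem_attractor (h0 : 0 < α) (h1 : α < 1 / 3) (i : Fin 3) :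
    p (letter i) ∈ attractor α := by
  have h := side_mem_attractor h0 h1 (i + 2) (t := 0) (by simp)
  have hi : i + 2 + 1 = i := by rw [add_assoc]; exact add_zero i
  simpa [side, hi] using h

lemma vertex_mem_attractor (h0 : 0 < α) (h1 : α < 1 / 3) {n : ℕ} (w : Fin n → Fin 3)
    (i : Fin 3) : vertex α w i ∈ attractor α :=
  cellMap_mem_attractor h0 h1 n w (p_letter_mem_attractor h0 h1 i)

lemma segment_zero_mem_attractor (h0 : 0 < α) (h1 : α < 1 / 3) (w : Fin 0 → Fin 3) (i : Fin 3)
    {t : ℝ} (ht : t ∈ Set.Icc (0 : ℝ) 1) : segment α w i t ∈ attractor α := by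
  rw [segment_zero_eq_side]
  refine side_mem_attractor h0 h1 i ⟨?_, ?_⟩ <;> nlinarith [ht.1, ht.2]

/-- The cell of the attractor that is coded by the word `w`. -/
def cell (α : ℝ) {n : ℕ} (w : Fin n → Fin 3) : Set Plane := cellMap α n w '' attractor α

lemma isCompact_cell (h0 : 0 < α) (h1 : α < 1 / 3) {n : ℕ} (w : Fin n → Fin 3) :
    IsCompact (cell α w) :=
  (isCompact_attractor h0 h1).image (continuous_cellMap (by linarith) n w)

lemma cell_subset_attractor (h0 : 0 < α) (h1 : α < 1 / 3) {n : ℕ} (w : Fin n → Fin 3) :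
    cell α w ⊆ attractor α := by
  rintro _ ⟨x, hx, rfl⟩
  exact cellMap_mem_attractor h0 h1 n w hx

lemma vertex_mem_cell (h0 : 0 < α) (h1 : α < 1 / 3) {n : ℕ} (w : Fin n → Fin 3) (i : Fin 3) :
    vertex α w i ∈ cell α w := ⟨_, p_letter_mem_attractor h0 h1 i, rfl⟩

lemma segment_mem_cell (h0 : 0 < α) (h1 : α < 1 / 3) {n : ℕ} (w : Fin n → Fin 3) (i : Fin 3)
    {t : ℝ} (ht : t ∈ Set.Icc (0 : ℝ) 1) : segment α w i t ∈ cell α w :=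
  ⟨_, segment_zero_mem_attractor h0 h1 default i ht, (segment_eq_cellMap α w default i t).symm⟩

lemma segment_mem_attractor (h0 : 0 < α) (h1 : α < 1 / 3) {n : ℕ} (w : Fin n → Fin 3) (i : Fin 3)
    {t : ℝ} (ht : t ∈ Set.Icc (0 : ℝ) 1) : segment α w i t ∈ attractor α :=
  cell_subset_attractor h0 h1 w (segment_mem_cell h0 h1 w i ht)

lemma cell_subset_cell_init (h0 : 0 < α) (h1 : α < 1 / 3) {n : ℕ} (w : Fin (n + 1) → Fin 3) :
    cell α w ⊆ cell α (Fin.init w) := by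
  rintro _ ⟨x, hx, rfl⟩
  exact ⟨_, G_mem_attractor h0 h1 _ hx, (cellMap_succ α n w x).symm⟩

/-- A point of the attractor lies in a cell of level `n` or on a segment of a smaller level. -/
lemma mem_cell_or_mem_segment (h0 : 0 < α) (h1 : α < 1 / 3) (n : ℕ) {x : Plane}
    (hx : x ∈ attractor α) : (∃ w : Fin n → Fin 3, x ∈ cell α w) ∨
      ∃ (k : ℕ) (w : Fin k → Fin 3) (i : Fin 3), ∃ t ∈ Set.Icc (0 : ℝ) 1, x = segment α w i t := by
  induction n with
  | zero => exact Or.inl ⟨default, x, hx, rfl⟩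
  | succ n ih =>
    rcases ih with ⟨w, y, hy, rfl⟩ | h
    · rw [(isAttractor_attractor h0 h1).2.2] at hy
      obtain ⟨j, z, hz, rfl⟩ := Set.mem_iUnion.1 hy
      rcases letter_or_opp j with ⟨i, rfl⟩ | ⟨i, rfl⟩
      · exact Or.inl ⟨Fin.snoc w i, z, hz, cellMap_snoc α n w i z⟩
      · refine Or.inr ⟨n, w, i, bary (i + 2) z + bary i z / 2, ⟨?_, ?_⟩, ?_⟩
        · have := bary_nonneg h0 h1 hz i
          have := bary_nonneg h0 h1 hz (i + 2)
          positivity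
        · linarith [bary_sum i z, bary_nonneg h0 h1 hz i, bary_nonneg h0 h1 hz (i + 1)]
        · rw [segment_eq_cellMap α w default, ← G_opp]
    · exact Or.inr h

/-- Distinct cells of the same level are disjoint. -/
lemma cellMap_word_injective (h0 : 0 < α) (h1 : α < 1 / 3) {n : ℕ} {w v : Fin n → Fin 3}
    {x y : Plane} (hx : x ∈ attractor α) (hy : y ∈ attractor α)
    (h : cellMap α n w x = cellMap α n v y) : w = v := by
  induction n with
  | zero => exact Subsingleton.elim _ _
  | succ n ih =>
    simp only [cellMap, Function.comp] at h
    have hx' := cellMap_mem_attractor h0 h1 n (Fin.tail w) hx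
    have hy' := cellMap_mem_attractor h0 h1 n (Fin.tail v) hy
    have h00 : w 0 = v 0 := by
      by_contra hne
      -- Coordinate `w 0` is at least `(1 + α) / 2` on its own corner cell and at most `(1 - α) / 2`
      -- on the other two.
      have e := congrArg (bary (w 0)) h
      rw [bary_G_letter, bary_G_letter, if_pos rfl, if_neg (Ne.symm hne)] at e
      have l1 := bary_nonneg h0 h1 hx' (w 0)
      have l2 := bary_le_one h0 h1 hy' (w 0)
      nlinarith
    rw [h00] at h
    have e := dist_G_letter (by linarith) (v 0) (cellMap α n (Fin.tail w) x)
      (cellMap α n (Fin.tail v) y)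
    rw [h, dist_self] at e
    have e2 : dist (cellMap α n (Fin.tail w) x) (cellMap α n (Fin.tail v) y) = 0 := by
      have : (1 - α) / 2 ≠ 0 := by linarith
      rcases mul_eq_zero.1 e.symm with h | h
      · exact absurd h this
      · exact h
    have ht := ih (dist_eq_zero.1 e2)
    rw [← Fin.cons_self_tail w, ← Fin.cons_self_tail v, h00, ht]

lemma disjoint_cell (h0 : 0 < α) (h1 : α < 1 / 3) {n : ℕ} {w v : Fin n → Fin 3} (h : w ≠ v) :
    Disjoint (cell α w) (cell α v) := by
  rw [Set.disjoint_left]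
  rintro _ ⟨x, hx, rfl⟩ ⟨y, hy, e⟩
  exact h (cellMap_word_injective h0 h1 hx hy e.symm)

/-- The diameters of the cells tend to zero uniformly. -/
lemma exists_dist_cell_lt (h0 : 0 < α) (h1 : α < 1 / 3) {ε : ℝ} (hε : 0 < ε) :
    ∃ N, ∀ n ≥ N, ∀ w : Fin n → Fin 3, ∀ x ∈ cell α w, ∀ y ∈ cell α w, dist x y < ε := by
  have ht : Tendsto (fun n => ((1 - α) / 2) ^ n * Metric.diam (attractor α)) atTop (𝓝 0) := by
    have := (tendsto_pow_atTop_nhds_zero_of_lt_one (r := (1 - α) / 2) (by linarith)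
      (by linarith)).mul_const (Metric.diam (attractor α))
    simpa using this
  obtain ⟨N, hN⟩ := eventually_atTop.1 (ht.eventually_lt_const hε)
  refine ⟨N, fun n hn w => ?_⟩
  rintro _ ⟨x, hx, rfl⟩ _ ⟨y, hy, rfl⟩
  rw [dist_cellMap (by linarith)]
  refine lt_of_le_of_lt (mul_le_mul_of_nonneg_left ?_ ?_) (hN n hn)
  · exact Metric.dist_le_diam_of_mem (isCompact_attractor h0 h1).isBounded hx hy
  · have : 0 ≤ (1 - α) / 2 := by linarith
    positivity

end


/-! ### The weights -/

section Weights

variable {α : ℝ}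

lemma d_pos (h0 : 0 < α) (h1 : α < 1 / 3) (n : ℕ) : 0 < d α (n + 1) := by
  have : 0 < (1 - α) / 2 := by linarith
  rw [d]; positivity

lemma rD_pos (h0 : 0 < α) (h1 : α < 1 / 3) (n : ℕ) : 0 < rD α (n + 1) := by
  have := d_pos h0 h1 n
  rw [rD]; positivity

lemma rD_le (h0 : 0 < α) (h1 : α < 1 / 3) (n : ℕ) : rD α (n + 1) ≤ 3 / 5 := by
  have := d_pos h0 h1 n
  rw [rD]
  exact div_le_div_of_nonneg_left (by norm_num) (by norm_num) (by linarith)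

lemma rhoD_succ (α : ℝ) (n : ℕ) : rhoD α (n + 1) = rhoD α n * rD α (n + 1) :=
  Finset.prod_range_succ _ _

lemma rhoD_pos (h0 : 0 < α) (h1 : α < 1 / 3) (n : ℕ) : 0 < rhoD α n :=
  Finset.prod_pos fun i _ => rD_pos h0 h1 i

/-- This geometric decay makes vertex increments summable along nested cells. -/
lemma rhoD_le (h0 : 0 < α) (h1 : α < 1 / 3) (n : ℕ) : rhoD α n ≤ (3 / 5) ^ n := by
  induction n with
  | zero => simp [rhoD]
  | succ n ih =>
    rw [rhoD_succ, pow_succ]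
    exact mul_le_mul ih (rD_le h0 h1 n) (rD_pos h0 h1 n).le (by positivity)

lemma rhoC_succ (α : ℝ) (n : ℕ) : rhoC α (n + 1) = rhoD α n * rC α (n + 1) := rfl

lemma rhoC_pos (h0 : 0 < α) (h1 : α < 1 / 3) (n : ℕ) : 0 < rhoC α (n + 1) := by
  have := d_pos h0 h1 n
  rw [rhoC_succ, rC]
  exact mul_pos (rhoD_pos h0 h1 n) (by positivity)

lemma rhoC_le_one (h0 : 0 < α) (h1 : α < 1 / 3) (n : ℕ) : rhoC α (n + 1) ≤ 1 := by
  have := d_pos h0 h1 n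
  rw [rhoC_succ, rC]
  refine mul_le_one₀ ((rhoD_le h0 h1 n).trans (pow_le_one₀ (by norm_num) (by norm_num)))
    (by positivity) ?_
  rw [div_le_one (by positivity)]
  linarith

end Weights

/-! ### The renormalization inequality -/

/-- The energy of the corners of a triangle network is at most the renormalized energy of its
subdivision into three triangles and three connecting wires. -/
lemma renormalization_network {d : ℝ} (hd : 0 < d) (a ab ac ba b bc ca cb c : ℝ) :
    3 * d * ((b - c) ^ 2 + (c - a) ^ 2 + (a - b) ^ 2) ≤
      (5 + 3 * d) * (d * (((ab - ac) ^ 2 + (ac - a) ^ 2 + (a - ab) ^ 2) +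
        ((b - bc) ^ 2 + (bc - ba) ^ 2 + (ba - b) ^ 2) +
        ((cb - c) ^ 2 + (c - ca) ^ 2 + (ca - cb) ^ 2)) +
        ((ab - ba) ^ 2 + (bc - cb) ^ 2 + (ca - ac) ^ 2)) := by
  -- Resistors in series: resistances `1/(3d)`, `1`, `1/(3d)` add up to `(2 + 3d)/(3d)`. With `D = 2
  -- + 3d`, `series'` does the same for conductances `3D` and `9`.
  have series : ∀ x y z s : ℝ, x + y + z = s → 3 * d * s ^ 2 ≤
      (2 + 3 * d) * (3 * d * x ^ 2 + y ^ 2 + 3 * d * z ^ 2) := fun x y z s hs => by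
    subst hs
    linarith [mul_nonneg hd.le (sq_nonneg (x - z)), sq_nonneg (3 * d * x - y),
      sq_nonneg (3 * d * z - y)]
  have series' : ∀ x y s : ℝ, x + y = s → 9 * (2 + 3 * d) * s ^ 2 ≤
      (5 + 3 * d) * (3 * (2 + 3 * d) * x ^ 2 + 9 * y ^ 2) := fun x y s hs => by
    subst hs
    linarith [sq_nonneg (3 * y - (2 + 3 * d) * x)]
  -- Delta–star transformation: `A`, `B`, `C` are the centres of the three small triangles, and `M`
  -- is the centre of the triangle they form.
  obtain ⟨A, hA⟩ : ∃ A, A = (a + ab + ac) / 3 := ⟨_, rfl⟩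
  obtain ⟨B, hB⟩ : ∃ B, B = (b + ba + bc) / 3 := ⟨_, rfl⟩
  obtain ⟨C, hC⟩ : ∃ C, C = (c + ca + cb) / 3 := ⟨_, rfl⟩
  obtain ⟨M, hM⟩ : ∃ M, M = (A + B + C) / 3 := ⟨_, rfl⟩
  obtain ⟨D, hD⟩ : ∃ D, D = 2 + 3 * d := ⟨_, rfl⟩
  have hDpos : 0 < D := by rw [hD]; positivity
  have hE : 5 + 3 * d = 3 + D := by rw [hD]; ring
  have e1 := series (A - ab) (ab - ba) (ba - B) (A - B) (by ring)
  have e2 := series (B - bc) (bc - cb) (cb - C) (B - C) (by ring)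
  have e3 := series (C - ca) (ca - ac) (ac - A) (C - A) (by ring)
  have f1 := series' (a - A) (A - M) (a - M) (by ring)
  have f2 := series' (b - B) (B - M) (b - M) (by ring)
  have f3 := series' (c - C) (C - M) (c - M) (by ring)
  have hmean : (A - B) ^ 2 + (B - C) ^ 2 + (C - A) ^ 2 =
      3 * ((A - M) ^ 2 + (B - M) ^ 2 + (C - M) ^ 2) := by rw [hM]; ring
  -- Any reference point `M` gives an upper bound, so `M` need not be the mean of `a`, `b`, `c`.
  have hpairs : (b - c) ^ 2 + (c - a) ^ 2 + (a - b) ^ 2 ≤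
      3 * ((a - M) ^ 2 + (b - M) ^ 2 + (c - M) ^ 2) := by
    have : (b - c) ^ 2 + (c - a) ^ 2 + (a - b) ^ 2 =
      3 * ((a - M) ^ 2 + (b - M) ^ 2 + (c - M) ^ 2) - ((a - M) + (b - M) + (c - M)) ^ 2 := by ring
    rw [this]
    exact sub_le_self _ (sq_nonneg _)
  have hTa : (ab - ac) ^ 2 + (ac - a) ^ 2 + (a - ab) ^ 2 =
      3 * ((a - A) ^ 2 + (A - ab) ^ 2 + (ac - A) ^ 2) := by rw [hA]; ring
  have hTb : (b - bc) ^ 2 + (bc - ba) ^ 2 + (ba - b) ^ 2 =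
      3 * ((b - B) ^ 2 + (B - bc) ^ 2 + (ba - B) ^ 2) := by rw [hB]; ring
  have hTc : (cb - c) ^ 2 + (c - ca) ^ 2 + (ca - cb) ^ 2 =
      3 * ((c - C) ^ 2 + (C - ca) ^ 2 + (cb - C) ^ 2) := by rw [hC]; ring
  rw [hTa, hTb, hTc, hE]
  rw [← hD] at e1 e2 e3
  rw [← hD, hE] at f1 f2 f3
  clear hTa hTb hTc hA hB hC hM hD series series' hE
  -- With the squares turned into atoms, it remains to combine the inequalities linearly, with
  -- coefficients in `d` and `D`.
  generalize (a - A) ^ 2 = x1 at *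
  generalize (b - B) ^ 2 = x2 at *
  generalize (c - C) ^ 2 = x3 at *
  generalize (A - M) ^ 2 = y1 at *
  generalize (B - M) ^ 2 = y2 at *
  generalize (C - M) ^ 2 = y3 at *
  generalize (a - M) ^ 2 = z1 at *
  generalize (b - M) ^ 2 = z2 at *
  generalize (c - M) ^ 2 = z3 at *
  generalize (A - B) ^ 2 = m1 at *
  generalize (B - C) ^ 2 = m2 at *
  generalize (C - A) ^ 2 = m3 at *
  generalize (A - ab) ^ 2 = s1 at *
  generalize (ba - B) ^ 2 = s2 at *
  generalize (B - bc) ^ 2 = s3 at *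
  generalize (cb - C) ^ 2 = s4 at *
  generalize (C - ca) ^ 2 = s5 at *
  generalize (ac - A) ^ 2 = s6 at *
  generalize (ab - ba) ^ 2 = t1 at *
  generalize (bc - cb) ^ 2 = t2 at *
  generalize (ca - ac) ^ 2 = t3 at *
  generalize (b - c) ^ 2 + (c - a) ^ 2 + (a - b) ^ 2 = P at *
  have g1 : 9 * D * (z1 + z2 + z3) ≤ (3 + D) * (3 * D * (x1 + x2 + x3) + 3 * (m1 + m2 + m3)) := by
    rw [hmean]; linarith
  have g2 : 3 * d * (m1 + m2 + m3) ≤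
      D * (3 * d * (s1 + s2 + s3 + s4 + s5 + s6) + (t1 + t2 + t3)) := by linarith
  have g3 := mul_le_mul_of_nonneg_left g1 hd.le
  have g4 := mul_le_mul_of_nonneg_left g2 (by positivity : 0 ≤ 3 + D)
  have g5 := mul_le_mul_of_nonneg_left hpairs (by positivity : 0 ≤ 3 * d * D)
  refine le_of_mul_le_mul_left ?_ hDpos
  linarith

/-- Here `X i j` is the value at corner `j` of subcell `i`. The diagonal entries are the corners of
the undivided cell, and each wire joins `X i j` to `X j i`. -/
lemma renormalization {d : ℝ} (hd : 0 < d) (X : Fin 3 → Fin 3 → ℝ) :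
    3 * d * ∑ j : Fin 3, (X (j + 1) (j + 1) - X (j + 2) (j + 2)) ^ 2 ≤
      (5 + 3 * d) * (d * (∑ i : Fin 3, ∑ j : Fin 3, (X i (j + 1) - X i (j + 2)) ^ 2) +
        ∑ i : Fin 3, (X (i + 2) (i + 1) - X (i + 1) (i + 2)) ^ 2) := by
  refine le_of_le_of_eq (le_of_eq_of_le ?_ (renormalization_network hd (X 0 0) (X 0 1) (X 0 2)
    (X 1 0) (X 1 1) (X 1 2) (X 2 0) (X 2 1) (X 2 2))) ?_
  · rw [Fin.sum_univ_three]
    rfl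
  · simp only [Fin.sum_univ_three]
    norm_num
    simp only [show (1 : Fin 3) + 2 = 0 from rfl, show (2 : Fin 3) + 1 = 0 from rfl,
      show (2 : Fin 3) + 2 = 1 from rfl, show (1 : Fin 3) + 1 = 2 from rfl]
    left
    ring

/-! ### Functions on the attractor -/

section

variable {α : ℝ}

lemma ext_apply (u : attractor α → ℝ) {x : Plane} (hx : x ∈ attractor α) :
    ext u x = u ⟨x, hx⟩ :=
  Subtype.val_injective.extend_apply u 0 ⟨x, hx⟩

lemma ext_apply_of_notMem (u : attractor α → ℝ) {x : Plane} (hx : x ∉ attractor α) :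
    ext u x = 0 :=
  Function.extend_apply' _ _ _ (by rintro ⟨y, rfl⟩; exact hx y.2)

lemma ext_add (u v : attractor α → ℝ) : ext (u + v) = ext u + ext v := by
  funext x
  by_cases hx : x ∈ attractor α
  · simp [ext_apply _ hx]
  · simp [ext_apply_of_notMem _ hx]

lemma ext_smul (c : ℝ) (u : attractor α → ℝ) : ext (c • u) = c • ext u := by
  funext x
  by_cases hx : x ∈ attractor α
  · simp [ext_apply _ hx]
  · simp [ext_apply_of_notMem _ hx]

/-- The condition at zero is needed because `ext` vanishes off the attractor. -/
lemma ext_comp {ψ : ℝ → ℝ} (hψ : ψ 0 = 0) (u : attractor α → ℝ) : ext (ψ ∘ u) = ψ ∘ ext u := by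
  funext x
  by_cases hx : x ∈ attractor α
  · simp [ext_apply _ hx]
  · simp [ext_apply_of_notMem _ hx, hψ]

lemma onSegment_add (u v : attractor α → ℝ) {n : ℕ} (w : Fin n → Fin 3) (i : Fin 3) :
    onSegment (u + v) w i = onSegment u w i + onSegment v w i := by
  funext t; simp [onSegment, ext_add]

lemma onSegment_smul (c : ℝ) (u : attractor α → ℝ) {n : ℕ} (w : Fin n → Fin 3) (i : Fin 3) :
    onSegment (c • u) w i = c • onSegment u w i := by
  funext t; simp [onSegment, ext_smul]

lemma onSegment_sub (u v : attractor α → ℝ) {n : ℕ} (w : Fin n → Fin 3) (i : Fin 3) :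
    onSegment (u - v) w i = onSegment u w i - onSegment v w i := by
  rw [sub_eq_add_neg, ← neg_one_smul ℝ v, onSegment_add, onSegment_smul, neg_one_smul,
    ← sub_eq_add_neg]

lemma onSegment_comp {ψ : ℝ → ℝ} (hψ : ψ 0 = 0) (u : attractor α → ℝ) {n : ℕ}
    (w : Fin n → Fin 3) (i : Fin 3) : onSegment (ψ ∘ u) w i = ψ ∘ onSegment u w i := by
  funext t; simp [onSegment, ext_comp hψ]

/-- `u` is in `H¹` on all connecting segments. -/
def IsH1OnSegments (u : attractor α → ℝ) : Prop :=
  ∀ (n : ℕ) (w : Fin n → Fin 3) (i : Fin 3), MemH1 (onSegment u w i)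

lemma IsH1OnSegments.add {u v : attractor α → ℝ} (hu : IsH1OnSegments u)
    (hv : IsH1OnSegments v) : IsH1OnSegments (u + v) := fun n w i => by
  rw [onSegment_add]; exact (hu n w i).add (hv n w i)

lemma IsH1OnSegments.smul (c : ℝ) {u : attractor α → ℝ} (hu : IsH1OnSegments u) :
    IsH1OnSegments (c • u) := fun n w i => by
  rw [onSegment_smul]; exact (hu n w i).smul c

lemma IsH1OnSegments.sub {u v : attractor α → ℝ} (hu : IsH1OnSegments u)
    (hv : IsH1OnSegments v) : IsH1OnSegments (u - v) := fun n w i => by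
  rw [onSegment_sub]; exact (hu n w i).sub (hv n w i)

/-- The increment of `u` along a side of a cell. -/
def increment (u : attractor α → ℝ) {n : ℕ} (w : Fin n → Fin 3) (i : Fin 3) : ℝ :=
  ext u (vertex α w (i + 1)) - ext u (vertex α w (i + 2))

lemma increment_add (u v : attractor α → ℝ) {n : ℕ} (w : Fin n → Fin 3) (i : Fin 3) :
    increment (u + v) w i = increment u w i + increment v w i := by
  simp only [increment, ext_add, Pi.add_apply]; ring

lemma increment_smul (c : ℝ) (u : attractor α → ℝ) {n : ℕ} (w : Fin n → Fin 3) (i : Fin 3) :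
    increment (c • u) w i = c * increment u w i := by
  simp only [increment, ext_smul, Pi.smul_apply, smul_eq_mul]; ring

/-- The bilinear form of the energy at level `n`. -/
def levelForm (n : ℕ) (u v : attractor α → ℝ) : ℝ :=
  (rhoD α n)⁻¹ * (∑ w : Fin n → Fin 3, ∑ i : Fin 3, increment u w i * increment v w i) +
    ∑ k ∈ Finset.range n, (rhoC α (k + 1))⁻¹ *
      ∑ w : Fin k → Fin 3, ∑ i : Fin 3, h1Inner (onSegment u w i) (onSegment v w i)

lemma segmentEnergy_eq (k : ℕ) (u : attractor α → ℝ) : segmentEnergy k u =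
    ∑ w : Fin k → Fin 3, ∑ i : Fin 3, h1Inner (onSegment u w i) (onSegment u w i) := by
  simp only [segmentEnergy, h1Inner_self]

lemma discreteEnergy_eq (n : ℕ) (u : attractor α → ℝ) : discreteEnergy n u =
    ∑ w : Fin n → Fin 3, ∑ i : Fin 3, increment u w i ^ 2 := rfl

lemma levelForm_self (n : ℕ) (u : attractor α → ℝ) : levelForm n u u = levelEnergy n u := by
  simp only [levelForm, levelEnergy, segmentEnergy_eq, discreteEnergy_eq, sq]

lemma levelForm_comm (n : ℕ) (u v : attractor α → ℝ) : levelForm n u v = levelForm n v u := by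
  simp only [levelForm, h1Inner_comm (onSegment u _ _), mul_comm (increment u _ _)]

lemma levelForm_add_left (n : ℕ) {u v z : attractor α → ℝ} (hu : IsH1OnSegments u)
    (hv : IsH1OnSegments v) (hz : IsH1OnSegments z) :
    levelForm n (u + v) z = levelForm n u z + levelForm n v z := by
  simp only [levelForm, increment_add, onSegment_add,
    h1Inner_add_left (hu _ _ _) (hv _ _ _) (hz _ _ _), add_mul, Finset.sum_add_distrib, mul_add]
  ring

lemma levelForm_smul_left (n : ℕ) (c : ℝ) (u z : attractor α → ℝ) :
    levelForm n (c • u) z = c * levelForm n u z := by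
  simp only [levelForm, increment_smul, onSegment_smul, h1Inner_smul_left, mul_assoc,
    ← Finset.mul_sum, mul_left_comm _ c, ← mul_add]

lemma levelEnergy_smul (n : ℕ) (c : ℝ) (u : attractor α → ℝ) :
    levelEnergy n (c • u) = c ^ 2 * levelEnergy n u := by
  rw [← levelForm_self, levelForm_smul_left, levelForm_comm, levelForm_smul_left, levelForm_self]
  ring

lemma levelEnergy_add (n : ℕ) {u v : attractor α → ℝ} (hu : IsH1OnSegments u)
    (hv : IsH1OnSegments v) :
    levelEnergy n (u + v) = levelEnergy n u + 2 * levelForm n u v + levelEnergy n v := by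
  rw [← levelForm_self, levelForm_add_left n hu hv (hu.add hv), levelForm_comm n u,
    levelForm_comm n v, levelForm_add_left n hu hv hu, levelForm_add_left n hu hv hv,
    levelForm_self, levelForm_self, levelForm_comm n v u]
  ring

lemma segmentEnergy_nonneg (k : ℕ) (u : attractor α → ℝ) : 0 ≤ segmentEnergy k u := by
  rw [segmentEnergy_eq]
  exact Finset.sum_nonneg fun w _ => Finset.sum_nonneg fun i _ => h1Inner_self_nonneg _

lemma discreteEnergy_nonneg (n : ℕ) (u : attractor α → ℝ) : 0 ≤ discreteEnergy n u :=
  Finset.sum_nonneg fun _ _ => Finset.sum_nonneg fun _ _ => sq_nonneg _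

lemma levelEnergy_nonneg (h0 : 0 < α) (h1 : α < 1 / 3) (n : ℕ) (u : attractor α → ℝ) :
    0 ≤ levelEnergy n u :=
  add_nonneg (mul_nonneg (inv_nonneg.2 (rhoD_pos h0 h1 n).le) (discreteEnergy_nonneg n u))
    (Finset.sum_nonneg fun k _ =>
      mul_nonneg (inv_nonneg.2 (rhoC_pos h0 h1 k).le) (segmentEnergy_nonneg k u))

lemma levelEnergy_add_le (h0 : 0 < α) (h1 : α < 1 / 3) (n : ℕ) {u v : attractor α → ℝ}
    (hu : IsH1OnSegments u) (hv : IsH1OnSegments v) :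
    levelEnergy n (u + v) ≤ 2 * levelEnergy n u + 2 * levelEnergy n v := by
  have h2 := levelEnergy_add n hu (hv.smul (-1))
  rw [levelForm_comm, levelForm_smul_left, levelForm_comm, levelEnergy_smul] at h2
  have h3 := levelEnergy_nonneg h0 h1 n (u + (-1 : ℝ) • v)
  rw [levelEnergy_add n hu hv]
  linarith

lemma sum_word_succ {n : ℕ} (f : (Fin (n + 1) → Fin 3) → ℝ) :
    ∑ v, f v = ∑ w : Fin n → Fin 3, ∑ i : Fin 3, f (Fin.snoc w i) := by
  rw [← (Fin.snocEquiv fun _ => Fin 3).sum_comp, Fintype.sum_prod_type, Finset.sum_comm]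
  rfl

/-- The network inequality is applied cell by cell, and each wire term is bounded by its Dirichlet
integral. -/
lemma discreteEnergy_le (h0 : 0 < α) (h1 : α < 1 / 3) (n : ℕ) {u : attractor α → ℝ}
    (hu : IsH1OnSegments u) :
    3 * d α (n + 1) * discreteEnergy n u ≤ (5 + 3 * d α (n + 1)) *
      (d α (n + 1) * discreteEnergy (n + 1) u + segmentEnergy n u) := by
  rw [discreteEnergy, discreteEnergy, sum_word_succ, segmentEnergy_eq, Finset.mul_sum,
    Finset.mul_sum, ← Finset.sum_add_distrib, Finset.mul_sum]
  refine Finset.sum_le_sum fun w _ => ?_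
  have hd := d_pos h0 h1 n
  have key := renormalization hd
    (fun i j => ext u (vertex α (Fin.snoc w i : Fin (n + 1) → Fin 3) j))
  simp only [vertex_snoc_self] at key
  refine key.trans (mul_le_mul_of_nonneg_left (add_le_add le_rfl ?_) (by positivity))
  refine Finset.sum_le_sum fun i _ => ?_
  have := (hu n w i).sq_sub_le le_rfl zero_le_one le_rfl
  simpa only [onSegment, segment_start, segment_end] using this

lemma levelEnergy_le_succ (h0 : 0 < α) (h1 : α < 1 / 3) (n : ℕ) {u : attractor α → ℝ}
    (hu : IsH1OnSegments u) : levelEnergy n u ≤ levelEnergy (n + 1) u := by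
  have hd := d_pos h0 h1 n
  have hρ := rhoD_pos h0 h1 n
  rw [levelEnergy, levelEnergy, Finset.sum_range_succ, rhoC_succ, rhoD_succ, rD, rC]
  have key := discreteEnergy_le h0 h1 n hu
  -- The two new weights share the factor `(5 + 3d) / (3d)` of the network inequality, so the level
  -- energy cannot decrease.
  have e : (rhoD α n * (3 / (5 + 3 * d α (n + 1))))⁻¹ * discreteEnergy (n + 1) u +
      (rhoD α n * (3 * d α (n + 1) / (5 + 3 * d α (n + 1))))⁻¹ * segmentEnergy n u =
      (rhoD α n)⁻¹ * ((5 + 3 * d α (n + 1)) *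
        (d α (n + 1) * discreteEnergy (n + 1) u + segmentEnergy n u) / (3 * d α (n + 1))) := by
    field_simp
  have k2 : discreteEnergy n u ≤ (5 + 3 * d α (n + 1)) *
      (d α (n + 1) * discreteEnergy (n + 1) u + segmentEnergy n u) / (3 * d α (n + 1)) := by
    rw [le_div_iff₀ (by positivity)]; linarith
  have k3 := mul_le_mul_of_nonneg_left k2 (inv_nonneg.2 hρ.le)
  rw [← e] at k3
  linarith

lemma monotone_levelEnergy (h0 : 0 < α) (h1 : α < 1 / 3) {u : attractor α → ℝ}
    (hu : IsH1OnSegments u) : Monotone fun n => levelEnergy n u :=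
  monotone_nat_of_le_succ fun n => levelEnergy_le_succ h0 h1 n hu

/-! ### The form domain -/

lemma tendsto_levelEnergy {u : attractor α → ℝ} (hu : u ∈ F α) :
    Tendsto (fun n => levelEnergy n u) atTop (𝓝 (energy u)) := by
  obtain ⟨l, hl⟩ := hu.2.2
  rwa [energy, hl.limUnder_eq]

lemma levelEnergy_le_energy (h0 : 0 < α) (h1 : α < 1 / 3) {u : attractor α → ℝ} (hu : u ∈ F α)
    (n : ℕ) : levelEnergy n u ≤ energy u :=
  (monotone_levelEnergy h0 h1 hu.2.1).ge_of_tendsto (tendsto_levelEnergy hu) n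

lemma energy_le {u : attractor α → ℝ} (hu : u ∈ F α) {C : ℝ} (h : ∀ n, levelEnergy n u ≤ C) :
    energy u ≤ C :=
  le_of_tendsto' (tendsto_levelEnergy hu) h

lemma energy_nonneg (h0 : 0 < α) (h1 : α < 1 / 3) {u : attractor α → ℝ} (hu : u ∈ F α) :
    0 ≤ energy u :=
  ge_of_tendsto' (tendsto_levelEnergy hu) fun n => levelEnergy_nonneg h0 h1 n u

lemma mem_F_of_le (h0 : 0 < α) (h1 : α < 1 / 3) {u : attractor α → ℝ} (hc : Continuous u)
    (hu : IsH1OnSegments u) {C : ℝ} (h : ∀ n, levelEnergy n u ≤ C) : u ∈ F α :=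
  ⟨hc, hu, _, tendsto_atTop_ciSup (monotone_levelEnergy h0 h1 hu)
    ⟨C, by rintro _ ⟨n, rfl⟩; exact h n⟩⟩

/-- `𝓕` as a linear space. -/
def formSpace (h0 : 0 < α) (h1 : α < 1 / 3) : Submodule ℝ (attractor α → ℝ) where
  carrier := F α
  add_mem' := fun {u v} hu hv => mem_F_of_le h0 h1 (hu.1.add hv.1)
    (IsH1OnSegments.add hu.2.1 hv.2.1) fun n =>
      (levelEnergy_add_le h0 h1 n hu.2.1 hv.2.1).trans
        (add_le_add (mul_le_mul_of_nonneg_left (levelEnergy_le_energy h0 h1 hu n) zero_le_two)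
          (mul_le_mul_of_nonneg_left (levelEnergy_le_energy h0 h1 hv n) zero_le_two))
  zero_mem' := by
    have hz : ∀ n, levelEnergy n (0 : attractor α → ℝ) = 0 := fun n => by
      simpa using levelEnergy_smul n 0 (0 : attractor α → ℝ)
    refine mem_F_of_le h0 h1 continuous_zero (fun n w i => ?_) fun n => (hz n).le
    refine memH1_of_dist_le (C := 0) fun s _ t _ => ?_
    have : onSegment (0 : attractor α → ℝ) w i = 0 := by
      simpa using onSegment_smul 0 (0 : attractor α → ℝ) w i
    simp [this]
  smul_mem' := fun c u hu => mem_F_of_le h0 h1 (hu.1.const_smul c)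
    (IsH1OnSegments.smul c hu.2.1) fun n => by
      rw [levelEnergy_smul]
      exact mul_le_mul_of_nonneg_left (levelEnergy_le_energy h0 h1 hu n) (sq_nonneg c)

/-- The polarized energy is defined through limits. Identifying it as the limit of the level forms
transfers bilinearity. -/
lemma tendsto_levelForm (h0 : 0 < α) (h1 : α < 1 / 3) {u v : attractor α → ℝ} (hu : u ∈ F α)
    (hv : v ∈ F α) : Tendsto (fun n => levelForm n u v) atTop (𝓝 (energyForm u v)) := by
  have huv : u + v ∈ F α := (formSpace h0 h1).add_mem hu hv
  refine ((((tendsto_levelEnergy huv).sub (tendsto_levelEnergy hu)).sub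
    (tendsto_levelEnergy hv)).div_const 2).congr fun n => ?_
  rw [levelEnergy_add n hu.2.1 hv.2.1]
  ring

lemma energyForm_self (h0 : 0 < α) (h1 : α < 1 / 3) {u : attractor α → ℝ} (hu : u ∈ F α) :
    energyForm u u = energy u :=
  tendsto_nhds_unique (tendsto_levelForm h0 h1 hu hu)
    ((tendsto_levelEnergy hu).congr fun n => (levelForm_self n u).symm)

lemma energyForm_comm (u v : attractor α → ℝ) : energyForm u v = energyForm v u := by
  rw [energyForm, energyForm, add_comm u v]; ring

lemma energyForm_add_left (h0 : 0 < α) (h1 : α < 1 / 3) {u v z : attractor α → ℝ} (hu : u ∈ F α)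
    (hv : v ∈ F α) (hz : z ∈ F α) :
    energyForm (u + v) z = energyForm u z + energyForm v z :=
  tendsto_nhds_unique (tendsto_levelForm h0 h1 ((formSpace h0 h1).add_mem hu hv) hz)
    (((tendsto_levelForm h0 h1 hu hz).add (tendsto_levelForm h0 h1 hv hz)).congr fun n =>
      (levelForm_add_left n hu.2.1 hv.2.1 hz.2.1).symm)

lemma energyForm_smul_left (h0 : 0 < α) (h1 : α < 1 / 3) (c : ℝ) {u z : attractor α → ℝ}
    (hu : u ∈ F α) (hz : z ∈ F α) : energyForm (c • u) z = c * energyForm u z :=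
  tendsto_nhds_unique (tendsto_levelForm h0 h1 ((formSpace h0 h1).smul_mem c hu) hz)
    (((tendsto_levelForm h0 h1 hu hz).const_mul c).congr fun n =>
      (levelForm_smul_left n c u z).symm)

/-- The polarized energy as a bilinear form. -/
def bilinearForm (h0 : 0 < α) (h1 : α < 1 / 3) :
    formSpace h0 h1 →ₗ[ℝ] formSpace h0 h1 →ₗ[ℝ] ℝ :=
  LinearMap.mk₂ ℝ (fun u v => energyForm u.1 v.1)
    (fun u v z => energyForm_add_left h0 h1 u.2 v.2 z.2)
    (fun c u z => energyForm_smul_left h0 h1 c u.2 z.2)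
    (fun u v z => by
      rw [energyForm_comm u.1, energyForm_comm u.1, energyForm_comm u.1]
      exact energyForm_add_left h0 h1 v.2 z.2 u.2)
    (fun c u z => by
      rw [energyForm_comm u.1, energyForm_comm u.1]
      exact energyForm_smul_left h0 h1 c z.2 u.2)

/-- Normal contractions operate on the form. -/
lemma levelEnergy_comp_le (h0 : 0 < α) (h1 : α < 1 / 3) {ψ : ℝ → ℝ} (hψ0 : ψ 0 = 0)
    (hψ : ∀ s t, |ψ s - ψ t| ≤ |s - t|) {u : attractor α → ℝ} (hu : IsH1OnSegments u) (n : ℕ) :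
    levelEnergy n (ψ ∘ u) ≤ levelEnergy n u := by
  refine add_le_add (mul_le_mul_of_nonneg_left ?_ (inv_nonneg.2 (rhoD_pos h0 h1 n).le))
    (Finset.sum_le_sum fun k _ =>
      mul_le_mul_of_nonneg_left ?_ (inv_nonneg.2 (rhoC_pos h0 h1 k).le))
  · refine Finset.sum_le_sum fun w _ => Finset.sum_le_sum fun i _ => ?_
    rw [ext_comp hψ0]
    exact sq_le_sq.2 (hψ _ _)
  · rw [segmentEnergy_eq, segmentEnergy_eq]
    refine Finset.sum_le_sum fun w _ => Finset.sum_le_sum fun i _ => ?_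
    rw [onSegment_comp hψ0]
    exact h1Inner_comp_le hψ (hu k w i)

lemma comp_mem_F (h0 : 0 < α) (h1 : α < 1 / 3) {ψ : ℝ → ℝ} (hψ0 : ψ 0 = 0)
    (hψ : ∀ s t, |ψ s - ψ t| ≤ |s - t|) {u : attractor α → ℝ} (hu : u ∈ F α) :
    ψ ∘ u ∈ F α ∧ energy (ψ ∘ u) ≤ energy u := by
  have hle : ∀ n, levelEnergy n (ψ ∘ u) ≤ energy u := fun n =>
    (levelEnergy_comp_le h0 h1 hψ0 hψ hu.2.1 n).trans (levelEnergy_le_energy h0 h1 hu n)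
  have hcont : Continuous ψ := (LipschitzWith.of_dist_le_mul (K := 1) fun s t => by
    simpa [Real.dist_eq] using hψ s t).continuous
  have hmem : ψ ∘ u ∈ F α := mem_F_of_le h0 h1 (hcont.comp hu.1)
    (fun n w i => by rw [onSegment_comp hψ0]; exact (hu.2.1 n w i).comp hψ) hle
  exact ⟨hmem, energy_le hmem hle⟩

end


/-! ### The uniform bound -/

section

variable {α : ℝ}

lemma rhoD_inv_mul_discreteEnergy_le (h0 : 0 < α) (h1 : α < 1 / 3) (n : ℕ)
    (u : attractor α → ℝ) : (rhoD α n)⁻¹ * discreteEnergy n u ≤ levelEnergy n u :=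
  le_add_of_nonneg_right (Finset.sum_nonneg fun k _ =>
    mul_nonneg (inv_nonneg.2 (rhoC_pos h0 h1 k).le) (segmentEnergy_nonneg k u))

lemma segmentEnergy_le_levelEnergy (h0 : 0 < α) (h1 : α < 1 / 3) (n : ℕ)
    (u : attractor α → ℝ) : segmentEnergy n u ≤ levelEnergy (n + 1) u := by
  rw [levelEnergy, Finset.sum_range_succ]
  have e1 := mul_nonneg (inv_nonneg.2 (rhoD_pos h0 h1 (n + 1)).le) (discreteEnergy_nonneg (n + 1) u)
  have e2 : 0 ≤ ∑ k ∈ Finset.range n, (rhoC α (k + 1))⁻¹ * segmentEnergy k u :=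
    Finset.sum_nonneg fun k _ =>
      mul_nonneg (inv_nonneg.2 (rhoC_pos h0 h1 k).le) (segmentEnergy_nonneg k u)
  have e3 : 1 ≤ (rhoC α (n + 1))⁻¹ :=
    (one_le_inv₀ (rhoC_pos h0 h1 n)).2 (rhoC_le_one h0 h1 n)
  have e4 := le_mul_of_one_le_left (segmentEnergy_nonneg n u) e3
  linarith

lemma h1Inner_onSegment_le_energy (h0 : 0 < α) (h1 : α < 1 / 3) {u : attractor α → ℝ}
    (hu : u ∈ F α) {n : ℕ} (w : Fin n → Fin 3) (i : Fin 3) :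
    h1Inner (onSegment u w i) (onSegment u w i) ≤ energy u := by
  refine le_trans ?_ ((segmentEnergy_le_levelEnergy h0 h1 n u).trans
    (levelEnergy_le_energy h0 h1 hu (n + 1)))
  rw [segmentEnergy_eq]
  refine (Finset.single_le_sum (f := fun i => h1Inner (onSegment u w i) (onSegment u w i))
    (fun i _ => h1Inner_self_nonneg _) (Finset.mem_univ i)).trans ?_
  exact Finset.single_le_sum (f := fun w => ∑ i, h1Inner (onSegment u w i) (onSegment u w i))
    (fun w _ => Finset.sum_nonneg fun i _ => h1Inner_self_nonneg _) (Finset.mem_univ w)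

lemma abs_increment_le (h0 : 0 < α) (h1 : α < 1 / 3) {u : attractor α → ℝ} (hu : u ∈ F α) {n : ℕ}
    (w : Fin n → Fin 3) (i : Fin 3) : |increment u w i| ≤ (4 / 5) ^ n * √(energy u) := by
  have hE := energy_nonneg h0 h1 hu
  have hρ := rhoD_pos h0 h1 n
  have e1 : increment u w i ^ 2 ≤ discreteEnergy n u := by
    rw [discreteEnergy_eq]
    refine (Finset.single_le_sum (f := fun i => increment u w i ^ 2)
      (fun i _ => sq_nonneg _) (Finset.mem_univ i)).trans ?_
    exact Finset.single_le_sum (f := fun w => ∑ i, increment u w i ^ 2)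
      (fun w _ => Finset.sum_nonneg fun i _ => sq_nonneg _) (Finset.mem_univ w)
  have e2 := (rhoD_inv_mul_discreteEnergy_le h0 h1 n u).trans (levelEnergy_le_energy h0 h1 hu n)
  rw [inv_mul_le_iff₀ hρ] at e2
  refine abs_le_of_sq_le_sq ?_ (by positivity)
  rw [mul_pow, Real.sq_sqrt hE, ← pow_mul, mul_comm n 2, pow_mul]
  refine (e1.trans e2).trans (mul_le_mul_of_nonneg_right ?_ hE)
  -- The rational rate `4 / 5` replaces `√(3 / 5)`, since `3 / 5 ≤ (4 / 5) ^ 2`.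
  exact (rhoD_le h0 h1 n).trans (pow_le_pow_left₀ (by norm_num) (by norm_num) n)

lemma abs_sub_vertex_le (h0 : 0 < α) (h1 : α < 1 / 3) {u : attractor α → ℝ} (hu : u ∈ F α) {n : ℕ}
    (w : Fin n → Fin 3) (i j : Fin 3) :
    |ext u (vertex α w i) - ext u (vertex α w j)| ≤ (4 / 5) ^ n * √(energy u) := by
  rcases fin_three_cases i j with rfl | rfl | rfl
  · rw [sub_self, abs_zero]; positivity
  · have := abs_increment_le h0 h1 hu w (j + 2)
    have e1 : j + 2 + 1 = j := by rw [add_assoc]; exact add_zero j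
    have e2 : j + 2 + 2 = j + 1 := by rw [add_assoc]; rfl
    rwa [increment, e1, e2, abs_sub_comm] at this
  · have := abs_increment_le h0 h1 hu w (j + 1)
    have e1 : j + 1 + 1 = j + 2 := by rw [add_assoc]; rfl
    have e2 : j + 1 + 2 = j := by rw [add_assoc]; exact add_zero j
    rwa [increment, e1, e2] at this

lemma abs_vertex_sub_le (h0 : 0 < α) (h1 : α < 1 / 3) {u : attractor α → ℝ} (hu : u ∈ F α) (n : ℕ)
    (w : Fin n → Fin 3) (i : Fin 3) :
    |ext u (vertex α w i) - ext u (p (letter 0))| ≤ 5 * √(energy u) := by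
  -- The factor `5 - 4 * (4 / 5) ^ n` is the partial sum of `(4 / 5) ^ m` over `m ≤ n`: one
  -- increment is paid at each level.
  suffices h : |ext u (vertex α w i) - ext u (p (letter 0))| ≤
      (5 - 4 * (4 / 5) ^ n) * √(energy u) from
    h.trans (mul_le_mul_of_nonneg_right (sub_le_self _ (by positivity)) (Real.sqrt_nonneg _))
  induction n generalizing i with
  | zero =>
    have := abs_sub_vertex_le h0 h1 hu w i 0
    norm_num at this ⊢
    exact this
  | succ n ih =>
    obtain ⟨v, j, rfl⟩ : ∃ (v : Fin n → Fin 3) (j : Fin 3), w = Fin.snoc v j :=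
      ⟨Fin.init w, w (Fin.last n), (Fin.snoc_init_self w).symm⟩
    have e1 := abs_sub_vertex_le h0 h1 hu (Fin.snoc v j : Fin (n + 1) → Fin 3) i j
    have e2 := ih v j
    rw [vertex_snoc_self] at e1
    refine (abs_sub_le _ _ _).trans ((add_le_add e1 e2).trans (le_of_eq ?_))
    rw [pow_succ]; ring

/-- A point is approximated by vertices of small cells, or it lies on a wire, where moving to the
endpoint costs one more `√(energy u)`. -/
lemma abs_sub_le_sqrt_energy (h0 : 0 < α) (h1 : α < 1 / 3) {u : attractor α → ℝ} (hu : u ∈ F α)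
    (x : attractor α) : |u x - ext u (p (letter 0))| ≤ 6 * √(energy u) := by
  refine le_of_forall_pos_le_add fun ε hε => ?_
  obtain ⟨δ, hδ, hcont⟩ := Metric.continuous_iff.1 hu.1 x ε hε
  obtain ⟨N, hN⟩ := exists_dist_cell_lt h0 h1 hδ
  rcases mem_cell_or_mem_segment h0 h1 N x.2 with ⟨w, hw⟩ | ⟨k, w, i, t, ht, hx⟩
  · have hv := vertex_mem_attractor h0 h1 w 0
    have e1 := hcont ⟨_, hv⟩ (hN N le_rfl w _ (vertex_mem_cell h0 h1 w 0) _ hw)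
    rw [← ext_apply u hv, Real.dist_eq, abs_sub_comm] at e1
    have e2 := abs_vertex_sub_le h0 h1 hu N w 0
    have := abs_sub_le (u x) (ext u (vertex α w 0)) (ext u (p (letter 0)))
    linarith [Real.sqrt_nonneg (energy u)]
  · have e1 := ((hu.2.1 k w i).sq_sub_le le_rfl ht.1 ht.2).trans
      (h1Inner_onSegment_le_energy h0 h1 hu w i)
    have e2 := Real.abs_le_sqrt e1
    have e3 := abs_vertex_sub_le h0 h1 hu (k + 1) (Fin.snoc w (i + 1)) (i + 2)
    rw [← segment_start] at e3
    rw [onSegment, onSegment, ← hx, ext_apply u x.2] at e2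
    have := abs_sub_le (u x) (ext u (segment α w i 0)) (ext u (p (letter 0)))
    linarith

lemma sq_le_of_mem_F (h0 : 0 < α) (h1 : α < 1 / 3) {u : attractor α → ℝ} (hu : u ∈ F α)
    (x y : attractor α) : u x ^ 2 ≤ 2 * u y ^ 2 + 288 * energy u := by
  have e1 := abs_sub_le_sqrt_energy h0 h1 hu x
  have e2 := abs_sub_le_sqrt_energy h0 h1 hu y
  rw [abs_sub_comm] at e2
  have e3 : |u x - u y| ≤ 12 * √(energy u) := by
    have := abs_sub_le (u x) (ext u (p (letter 0))) (u y)
    linarith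
  have e4 := sq_le_sq' (neg_le_of_abs_le e3) (le_of_abs_le e3)
  rw [mul_pow, Real.sq_sqrt (energy_nonneg h0 h1 hu)] at e4
  -- The inequality used is `a² ≤ 2b² + 2(a - b)²`, and `288 = 2 * 12 ^ 2`.
  nlinarith [sq_nonneg (u x - 2 * u y)]

/-- The energy norm controls the uniform norm. -/
lemma exists_sq_le (h0 : 0 < α) (h1 : α < 1 / 3) (μ : Measure (attractor α)) [IsFiniteMeasure μ]
    [μ.IsOpenPosMeasure] : ∃ C > 0, ∀ u ∈ F α, Integrable (fun x => u x ^ 2) μ → ∀ x,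
      u x ^ 2 ≤ C * (energy u + ∫ y, u y ^ 2 ∂μ) := by
  have : Nonempty (attractor α) := (isAttractor_attractor h0 h1).1.to_subtype
  have hμ : 0 < μ.real Set.univ :=
    ENNReal.toReal_pos (isOpen_univ.measure_ne_zero μ Set.univ_nonempty) (measure_ne_top _ _)
  refine ⟨288 + 2 / μ.real Set.univ, by positivity, fun u hu hi x => ?_⟩
  have hE := energy_nonneg h0 h1 hu
  -- The pointwise comparison is integrated in its second variable and divided by the total mass.
  have key : ∫ _, u x ^ 2 ∂μ ≤ ∫ y, (2 * u y ^ 2 + 288 * energy u) ∂μ :=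
    integral_mono (integrable_const _) ((hi.const_mul 2).add (integrable_const _))
      fun y => sq_le_of_mem_F h0 h1 hu x y
  rw [integral_const, integral_add (hi.const_mul 2) (integrable_const _), integral_const_mul,
    integral_const, smul_eq_mul, smul_eq_mul] at key
  have hI : 0 ≤ ∫ y, u y ^ 2 ∂μ := integral_nonneg fun _ => sq_nonneg _
  generalize ∫ y, u y ^ 2 ∂μ = I at *
  have k2 : u x ^ 2 ≤ 288 * energy u + 2 / μ.real Set.univ * I := by
    rw [div_mul_eq_mul_div, ← sub_le_iff_le_add', le_div_iff₀ hμ]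
    linarith
  have : 0 ≤ 2 / μ.real Set.univ * energy u := by positivity
  linarith

/-! ### Completeness -/

/-- At a fixed level the energy of `u₀ - u m` tends to zero, by pointwise convergence at vertices
and completeness of `H¹` on wires. The Cauchy property makes the bounds uniform in the level. -/
lemma mem_F_of_cauchy (h0 : 0 < α) (h1 : α < 1 / 3) {u : ℕ → attractor α → ℝ}
    (hu : ∀ m, u m ∈ F α) {u₀ : attractor α → ℝ} (hc : Continuous u₀)
    (hlim : ∀ x, Tendsto (fun m => u m x) atTop (𝓝 (u₀ x)))
    (hC : ∀ ε > 0, ∃ N, ∀ m ≥ N, ∀ n ≥ N, energy (u m - u n) < ε) :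
    u₀ ∈ F α ∧ Tendsto (fun m => energy (u m - u₀)) atTop (𝓝 0) := by
  have hsub : ∀ m n, u m - u n ∈ F α := fun m n => (formSpace h0 h1).sub_mem (hu m) (hu n)
  have hext : ∀ x, Tendsto (fun m => ext (u m) x) atTop (𝓝 (ext u₀ x)) := by
    intro x
    by_cases hx : x ∈ attractor α
    · simpa only [ext_apply _ hx] using hlim ⟨x, hx⟩
    · simp only [ext_apply_of_notMem _ hx, tendsto_const_nhds]
  have hH1 : ∀ (n : ℕ) (w : Fin n → Fin 3) (i : Fin 3), MemH1 (onSegment u₀ w i) ∧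
      Tendsto (fun m => h1Inner (onSegment u₀ w i - onSegment (u m) w i)
        (onSegment u₀ w i - onSegment (u m) w i)) atTop (𝓝 0) := by
    intro n w i
    refine memH1_of_cauchy (fun m => (hu m).2.1 n w i) (fun t _ => hext _) fun ε hε => ?_
    obtain ⟨N, hN⟩ := hC ε hε
    refine ⟨N, fun m hm k hk => lt_of_le_of_lt ?_ (hN m hm k hk)⟩
    rw [← onSegment_sub]
    exact h1Inner_onSegment_le_energy h0 h1 (hsub m k) w i
  have hu₀ : IsH1OnSegments u₀ := fun n w i => (hH1 n w i).1
  have hext0 : ∀ x, Tendsto (fun m => ext (u₀ - u m) x) atTop (𝓝 0) := by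
    intro x
    have := (tendsto_const_nhds (x := ext u₀ x)).sub (hext x)
    rw [sub_self] at this
    refine this.congr fun m => ?_
    rw [sub_eq_add_neg u₀, ← neg_one_smul ℝ (u m), ext_add, ext_smul]
    simp [sub_eq_add_neg]
  have hlevel : ∀ n, Tendsto (fun m => levelEnergy n (u₀ - u m)) atTop (𝓝 0) := by
    intro n
    have hd : Tendsto (fun m => discreteEnergy n (u₀ - u m)) atTop (𝓝 0) := by
      have := tendsto_finsetSum (Finset.univ : Finset (Fin n → Fin 3)) fun w _ =>
        tendsto_finsetSum (Finset.univ : Finset (Fin 3)) fun i _ =>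
          ((hext0 (vertex α w (i + 1))).sub (hext0 (vertex α w (i + 2)))).pow 2
      simpa [discreteEnergy] using this
    have hs : ∀ k, Tendsto (fun m => segmentEnergy k (u₀ - u m)) atTop (𝓝 0) := by
      intro k
      have := tendsto_finsetSum (Finset.univ : Finset (Fin k → Fin 3)) fun w _ =>
        tendsto_finsetSum (Finset.univ : Finset (Fin 3)) fun i _ => (hH1 k w i).2
      simp only [segmentEnergy_eq, onSegment_sub]
      simpa using this
    have := (hd.const_mul (rhoD α n)⁻¹).add (tendsto_finsetSum (Finset.range n) fun k _ =>
      (hs k).const_mul (rhoC α (k + 1))⁻¹)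
    simpa [levelEnergy] using this
  have hbound : ∀ ε > 0, ∃ N, ∀ m ≥ N, ∀ n, levelEnergy n (u₀ - u m) ≤ 2 * ε := by
    intro ε hε
    obtain ⟨N, hN⟩ := hC ε hε
    refine ⟨N, fun m hm n => ?_⟩
    -- The auxiliary index `l` goes to infinity with the level `n` fixed, so the threshold for `m`
    -- does not depend on `n`.
    have ht : Tendsto (fun l => 2 * levelEnergy n (u₀ - u l) + 2 * ε) atTop (𝓝 (2 * ε)) := by
      simpa using ((hlevel n).const_mul 2).add_const (2 * ε)
    refine ge_of_tendsto ht (eventually_atTop.2 ⟨N, fun l hl => ?_⟩)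
    have e1 := levelEnergy_add_le h0 h1 n (hu₀.sub (hu l).2.1) (hsub l m).2.1
    rw [sub_add_sub_cancel] at e1
    have e2 := levelEnergy_le_energy h0 h1 (hsub l m) n
    have e3 := hN l hl m hm
    linarith
  have hmem : ∀ ε > 0, ∃ N, ∀ m ≥ N, u₀ - u m ∈ F α ∧ energy (u₀ - u m) ≤ 2 * ε := by
    intro ε hε
    obtain ⟨N, hN⟩ := hbound ε hε
    refine ⟨N, fun m hm => ?_⟩
    have := mem_F_of_le h0 h1 (hc.sub (hu m).1) (hu₀.sub (hu m).2.1) (hN m hm)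
    exact ⟨this, energy_le this (hN m hm)⟩
  have h₀ : u₀ ∈ F α := by
    obtain ⟨N, hN⟩ := hmem 1 one_pos
    have := (formSpace h0 h1).add_mem (hN N le_rfl).1 (hu N)
    rwa [sub_add_cancel] at this
  refine ⟨h₀, ?_⟩
  rw [Metric.tendsto_atTop]
  intro ε hε
  obtain ⟨N, hN⟩ := hmem (ε / 4) (by positivity)
  refine ⟨N, fun m hm => ?_⟩
  have hneg : energy (u m - u₀) = energy (u₀ - u m) := by
    have : u m - u₀ = (-1 : ℝ) • (u₀ - u m) := by rw [neg_one_smul, neg_sub]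
    rw [energy, energy, this]
    simp only [levelEnergy_smul]
    norm_num
  rw [Real.dist_eq, sub_zero, hneg, abs_of_nonneg (energy_nonneg h0 h1 (hN m hm).1)]
  linarith [(hN m hm).2]

/-! ### Functions of finite energy are uniformly dense -/

lemma eq_on_cell_of_le (h0 : 0 < α) (h1 : α < 1 / 3) {g : Plane → ℝ} {n : ℕ}
    (hn : ∀ w : Fin n → Fin 3, ∀ x ∈ cell α w, ∀ y ∈ cell α w, g x = g y) {k : ℕ} (hk : n ≤ k) :
    ∀ w : Fin k → Fin 3, ∀ x ∈ cell α w, ∀ y ∈ cell α w, g x = g y := by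
  induction k, hk using Nat.le_induction with
  | base => exact hn
  | succ k _ ih =>
    exact fun w x hx y hy =>
      ih (Fin.init w) x (cell_subset_cell_init h0 h1 w hx) y (cell_subset_cell_init h0 h1 w hy)

/-- A Lipschitz function that is constant on the cells of some level has finite energy. -/
lemma mem_F_of_lipschitz (h0 : 0 < α) (h1 : α < 1 / 3) {g : Plane → ℝ} {L : NNReal}
    (hg : LipschitzWith L g) {n : ℕ}
    (hn : ∀ w : Fin n → Fin 3, ∀ x ∈ cell α w, ∀ y ∈ cell α w, g x = g y) :
    (fun x : attractor α => g x) ∈ F α := by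
  set u : attractor α → ℝ := fun x => g x with hu
  have hext : ∀ x ∈ attractor α, ext u x = g x := fun x hx => ext_apply u hx
  have hseg : ∀ (k : ℕ) (w : Fin k → Fin 3) (i : Fin 3), ∀ t ∈ Set.Icc (0 : ℝ) 1,
      onSegment u w i t = g (segment α w i t) := fun k w i t ht =>
    hext _ (segment_mem_attractor h0 h1 w i ht)
  have hH1 : IsH1OnSegments u := by
    intro k w i
    refine memH1_of_dist_le (C := L * ‖segment α w i 1 - segment α w i 0‖) fun s hs t ht => ?_
    rw [hseg k w i s hs, hseg k w i t ht, mul_assoc, mul_comm ‖_‖, ← dist_segment]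
    exact hg.dist_le_mul _ _
  have hle : ∀ m ≥ n, levelEnergy m u ≤ levelEnergy n u := by
    intro m hm
    induction m, hm using Nat.le_induction with
    | base => exact le_rfl
    | succ m hm ih =>
      have hd : discreteEnergy (m + 1) u = 0 := by
        refine Finset.sum_eq_zero fun w _ => Finset.sum_eq_zero fun i _ => ?_
        rw [hext _ (vertex_mem_attractor h0 h1 _ _), hext _ (vertex_mem_attractor h0 h1 _ _),
          eq_on_cell_of_le h0 h1 hn (hm.trans (Nat.le_succ m)) w _ (vertex_mem_cell h0 h1 w _) _
            (vertex_mem_cell h0 h1 w (i + 2)), sub_self, sq, zero_mul]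
      have hs : segmentEnergy m u = 0 := by
        rw [segmentEnergy_eq]
        refine Finset.sum_eq_zero fun w _ => Finset.sum_eq_zero fun i _ => ?_
        have : h1Inner (onSegment u w i) (onSegment u w i) = h1Inner (fun _ => 0) (fun _ => 0) := by
          refine h1Inner_congr (ae_unit_of_Ioo fun t ht => ?_)
          have : onSegment u w i =ᶠ[𝓝 t] fun _ => onSegment u w i t := by
            filter_upwards [Ioo_mem_nhds ht.1 ht.2] with s hs
            have hs' := Set.Ioo_subset_Icc_self hs
            have ht' := Set.Ioo_subset_Icc_self ht
            rw [hseg m w i s hs', hseg m w i t ht']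
            exact eq_on_cell_of_le h0 h1 hn hm w _ (segment_mem_cell h0 h1 w i hs') _
              (segment_mem_cell h0 h1 w i ht')
          rw [this.deriv_eq]
          simp
        rw [this]
        simp [h1Inner]
      refine le_trans ?_ ih
      rw [levelEnergy, levelEnergy, Finset.sum_range_succ, hd, hs, mul_zero, mul_zero, add_zero,
        zero_add]
      exact le_add_of_nonneg_left
        (mul_nonneg (inv_nonneg.2 (rhoD_pos h0 h1 m).le) (discreteEnergy_nonneg m u))
  refine mem_F_of_le h0 h1 (hg.continuous.comp continuous_subtype_val) hH1
    (C := levelEnergy n u) fun m => ?_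
  rcases le_total n m with h | h
  · exact hle m h
  · exact monotone_levelEnergy h0 h1 hH1 h

lemma const_mem_F (h0 : 0 < α) (h1 : α < 1 / 3) (c : ℝ) : (fun _ : attractor α => c) ∈ F α :=
  mem_F_of_lipschitz h0 h1 (g := fun _ => c) (LipschitzWith.const c) (n := 0)
    fun _ _ _ _ _ => rfl

/-- The separating function is a truncated distance, constant on each cell of a level so fine that
no cell contains both points. -/
lemma exists_mem_F_ne (h0 : 0 < α) (h1 : α < 1 / 3) {x y : attractor α} (hxy : x ≠ y) :
    ∃ u ∈ F α, u x ≠ u y := by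
  obtain ⟨n, hn⟩ := exists_dist_cell_lt h0 h1 (dist_pos.2 hxy)
  replace hn := hn n le_rfl
  -- The singletons are added because `x` or `y` may lie on a wire outside all cells of level `n`.
  -- Every such cell lies in `A` or in `B`.
  set B : Set Plane := {x.1} ∪ ⋃ w ∈ {w : Fin n → Fin 3 | x.1 ∈ cell α w}, cell α w with hB
  set A : Set Plane := {y.1} ∪ ⋃ w ∈ {w : Fin n → Fin 3 | x.1 ∉ cell α w}, cell α w with hA
  have hBc : IsCompact B := isCompact_singleton.union
    ((Set.toFinite _).isCompact_biUnion fun w _ => isCompact_cell h0 h1 w)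
  have hAc : IsCompact A := isCompact_singleton.union
    ((Set.toFinite _).isCompact_biUnion fun w _ => isCompact_cell h0 h1 w)
  have hdisj : Disjoint B A := by
    rw [Set.disjoint_left]
    intro z hzB hzA
    simp only [hB, hA, Set.mem_union, Set.mem_singleton_iff, Set.mem_iUnion, Set.mem_ofPred_eq,
      exists_prop] at hzA hzB
    rcases hzB with rfl | ⟨w, hw, hzw⟩
    · rcases hzA with h | ⟨v, hv, hzv⟩
      · exact hxy (Subtype.ext h)
      · exact hv hzv
    · rcases hzA with rfl | ⟨v, hv, hzv⟩
      · exact lt_irrefl _ (hn w _ hw _ hzw)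
      · have hne : w ≠ v := by rintro rfl; exact hv hw
        exact Set.disjoint_left.1 (disjoint_cell h0 h1 hne) hzw hzv
  obtain ⟨r, hr, hsep⟩ := Metric.exists_pos_forall_lt_edist hBc hAc.isClosed hdisj
  have hAne : A.Nonempty := ⟨y, Or.inl rfl⟩
  set g : Plane → ℝ := fun z => min (Metric.infDist z A) r with hg
  have hgB : ∀ z ∈ B, g z = r := by
    intro z hz
    refine min_eq_right ((Metric.le_infDist hAne).2 fun a ha => ?_)
    have := (hsep z hz a ha).le
    rw [edist_nndist, ENNReal.coe_le_coe] at this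
    exact_mod_cast this
  have hgA : ∀ z ∈ A, g z = 0 := by
    intro z hz
    simp [hg, Metric.infDist_zero_of_mem hz]
  have hgL : LipschitzWith 1 g := (Metric.lipschitz_infDist_pt A).min_const _
  refine ⟨_, mem_F_of_lipschitz h0 h1 hgL (n := n) ?_, ?_⟩
  · intro w a ha b hb
    by_cases hw : x.1 ∈ cell α w
    · have hsub : cell α w ⊆ B := fun z hz => Or.inr (Set.mem_biUnion (x := w) hw hz)
      rw [hgB a (hsub ha), hgB b (hsub hb)]
    · have hsub : cell α w ⊆ A := fun z hz => Or.inr (Set.mem_biUnion (x := w) hw hz)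
      rw [hgA a (hsub ha), hgA b (hsub hb)]
  · rw [hgB x (Or.inl rfl), hgA y (Or.inl rfl)]
    exact_mod_cast hr.ne'

lemma abs_comp_mem_F (h0 : 0 < α) (h1 : α < 1 / 3) {u : attractor α → ℝ} (hu : u ∈ F α) :
    (fun x => |u x|) ∈ F α :=
  (comp_mem_F h0 h1 (ψ := fun t => |t|) abs_zero abs_abs_sub_abs_le_abs_sub hu).1

/-- Being linear and closed under absolute values, 𝓕 is a lattice. With constants and point
separation, it interpolates any two values, as Stone–Weierstrass requires. -/
lemma exists_mem_F_near (h0 : 0 < α) (h1 : α < 1 / 3) {φ : attractor α → ℝ} (hφ : Continuous φ)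
    {ε : ℝ} (hε : 0 < ε) : ∃ ψ ∈ F α, ∀ x, |φ x - ψ x| < ε := by
  have : CompactSpace (attractor α) := isCompact_iff_compactSpace.1 (isCompact_attractor h0 h1)
  have hdense : closure {f : C(attractor α, ℝ) | ⇑f ∈ F α} = ⊤ := by
    refine ContinuousMap.sublattice_closure_eq_top _ ⟨0, (formSpace h0 h1).zero_mem⟩ ?_ ?_ ?_
    · intro f hf g hg
      have h := (formSpace h0 h1).smul_mem (1 / 2 : ℝ) ((formSpace h0 h1).sub_mem
        ((formSpace h0 h1).add_mem hf hg)
        (abs_comp_mem_F h0 h1 ((formSpace h0 h1).sub_mem hf hg)))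
      have e : ⇑(f ⊓ g) = (1 / 2 : ℝ) • (⇑f + ⇑g - fun x => |(⇑f - ⇑g) x|) := by
        funext x
        simp only [ContinuousMap.inf_apply, Pi.smul_apply, Pi.sub_apply, Pi.add_apply, smul_eq_mul]
        rcases le_total (f x) (g x) with h | h
        · rw [min_eq_left h, abs_of_nonpos (by linarith)]; ring
        · rw [min_eq_right h, abs_of_nonneg (by linarith)]; ring
      change ⇑(f ⊓ g) ∈ F α
      rw [e]; exact h
    · intro f hf g hg
      have h := (formSpace h0 h1).smul_mem (1 / 2 : ℝ) ((formSpace h0 h1).add_mem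
        ((formSpace h0 h1).add_mem hf hg)
        (abs_comp_mem_F h0 h1 ((formSpace h0 h1).sub_mem hf hg)))
      have e : ⇑(f ⊔ g) = (1 / 2 : ℝ) • (⇑f + ⇑g + fun x => |(⇑f - ⇑g) x|) := by
        funext x
        simp only [ContinuousMap.sup_apply, Pi.smul_apply, Pi.sub_apply, Pi.add_apply, smul_eq_mul]
        rcases le_total (f x) (g x) with h | h
        · rw [max_eq_right h, abs_of_nonpos (by linarith)]; ring
        · rw [max_eq_left h, abs_of_nonneg (by linarith)]; ring
      change ⇑(f ⊔ g) ∈ F α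
      rw [e]; exact h
    · intro v x y
      by_cases hxy : x = y
      · subst hxy
        exact ⟨ContinuousMap.const _ (v x), const_mem_F h0 h1 (v x), rfl, rfl⟩
      · obtain ⟨u, hu, hne⟩ := exists_mem_F_ne h0 h1 hxy
        have h := (formSpace h0 h1).add_mem (const_mem_F h0 h1 (v x))
          ((formSpace h0 h1).smul_mem ((v y - v x) / (u y - u x))
            ((formSpace h0 h1).sub_mem hu (const_mem_F h0 h1 (u x))))
        refine ⟨⟨_, h.1⟩, h, ?_, ?_⟩
        · simp
        · have : u y - u x ≠ 0 := sub_ne_zero.2 (Ne.symm hne)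
          simp [div_mul_cancel₀ _ this]
  have hmem : (⟨φ, hφ⟩ : C(attractor α, ℝ)) ∈ closure {f : C(attractor α, ℝ) | ⇑f ∈ F α} := by
    rw [hdense]; trivial
  obtain ⟨f, hf, hd⟩ := Metric.mem_closure_iff.1 hmem ε hε
  exact ⟨f, hf, fun x => (ContinuousMap.dist_apply_le_dist x).trans_lt hd⟩

/-! ### Locality -/

lemma onSegment_eventuallyEq_zero {u : attractor α → ℝ} {n : ℕ} {w : Fin n → Fin 3} {i : Fin 3}
    {t : ℝ} (ht : segment α w i t ∈ attractor α) (h : (⟨_, ht⟩ : attractor α) ∉ tsupport u) :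
    onSegment u w i =ᶠ[𝓝 t] 0 := by
  have h1 := notMem_tsupport_iff_eventuallyEq.1 h
  rw [EventuallyEq, nhds_subtype_eq_comap, eventually_comap] at h1
  have h2 : ∀ᶠ y in 𝓝 (segment α w i t), ext u y = 0 := by
    filter_upwards [h1] with y hy
    by_cases hyK : y ∈ attractor α
    · rw [ext_apply u hyK]; exact hy ⟨y, hyK⟩ rfl
    · exact ext_apply_of_notMem u hyK
  exact (continuous_segment α w i).continuousAt.eventually h2

lemma exists_vertex_ne_zero (h0 : 0 < α) (h1 : α < 1 / 3) {u : attractor α → ℝ} {n : ℕ}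
    {w : Fin n → Fin 3} {i : Fin 3} (h : increment u w i ≠ 0) :
    ∃ x : attractor α, x.1 ∈ cell α w ∧ u x ≠ 0 := by
  by_contra! hall
  have hz : ∀ j, ext u (vertex α w j) = 0 := fun j => by
    rw [ext_apply u (vertex_mem_attractor h0 h1 w j)]
    exact hall ⟨_, vertex_mem_attractor h0 h1 w j⟩ (vertex_mem_cell h0 h1 w j)
  exact h (by rw [increment, hz, hz, sub_zero])

lemma energyForm_eq_zero_of_disjoint (h0 : 0 < α) (h1 : α < 1 / 3) {u v : attractor α → ℝ}
    (hu : u ∈ F α) (hv : v ∈ F α) (hd : Disjoint (tsupport u) (tsupport v)) :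
    energyForm u v = 0 := by
  have : CompactSpace (attractor α) := isCompact_iff_compactSpace.1 (isCompact_attractor h0 h1)
  obtain ⟨r, hr, hsep⟩ := Metric.exists_pos_forall_lt_edist
    (isClosed_tsupport u).isCompact (isClosed_tsupport v) hd
  -- Only the discrete part needs a large level: cells of diameter below `r` cannot meet both
  -- supports. The wire terms vanish at every level.
  obtain ⟨N, hN⟩ := exists_dist_cell_lt h0 h1 (ε := r) (by exact_mod_cast hr)
  refine tendsto_nhds_unique (tendsto_levelForm h0 h1 hu hv)
    (tendsto_const_nhds.congr' (eventually_atTop.2 ⟨N, fun n hn => ?_⟩))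
  have hinc : ∀ (w : Fin n → Fin 3) (i : Fin 3), increment u w i * increment v w i = 0 := by
    intro w i
    by_contra hne
    obtain ⟨x, hx, hux⟩ := exists_vertex_ne_zero h0 h1 (left_ne_zero_of_mul hne)
    obtain ⟨y, hy, hvy⟩ := exists_vertex_ne_zero h0 h1 (right_ne_zero_of_mul hne)
    have e1 := hN n hn w x hx y hy
    have e2 := hsep x (subset_tsupport u hux) y (subset_tsupport v hvy)
    rw [edist_nndist, ENNReal.coe_lt_coe, ← NNReal.coe_lt_coe, coe_nndist] at e2
    exact lt_asymm e1 e2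
  have hinner : ∀ (k : ℕ) (w : Fin k → Fin 3) (i : Fin 3),
      h1Inner (onSegment u w i) (onSegment v w i) = 0 := by
    intro k w i
    have : h1Inner (onSegment u w i) (onSegment v w i) = h1Inner (fun _ => 0) (fun _ => 0) := by
      refine h1Inner_congr (ae_unit_of_Ioo fun t ht => ?_)
      have hK := segment_mem_attractor h0 h1 w i (Set.Ioo_subset_Icc_self ht)
      by_cases hx : (⟨_, hK⟩ : attractor α) ∈ tsupport u
      · have := (onSegment_eventuallyEq_zero hK (Set.disjoint_left.1 hd hx)).deriv_eq
        rw [this]; simp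
      · have := (onSegment_eventuallyEq_zero hK hx).deriv_eq
        rw [this]; simp
    rw [this]
    simp [h1Inner]
  simp only [levelForm, hinc, hinner, Finset.sum_const_zero, mul_zero, add_zero]

end

/-- Under full support, a nonempty open set where `u` is nonzero has positive measure. Disjointness
of the measure-theoretic supports thus passes to the topological ones. -/
lemma tsupport_subset_aeSupport {X : Type*} [MeasurableSpace X] [TopologicalSpace X]
    {μ : Measure X} [μ.IsOpenPosMeasure] {f u : X → ℝ} (hu : Continuous u) (h : f =ᵐ[μ] u) :
    tsupport u ⊆ aeSupport μ f := by
  intro x hx U hU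
  have e : (U ∩ Function.support f : Set X) =ᵐ[μ] (U ∩ Function.support u : Set X) := by
    refine (ae_eq_refl U).inter ?_
    filter_upwards [h] with y hy
    change (f y ≠ 0) = (u y ≠ 0)
    rw [hy]
  rw [measure_congr e]
  have hne : (interior U ∩ Function.support u).Nonempty :=
    mem_closure_iff.1 hx _ isOpen_interior (mem_interior_iff_mem_nhds.2 hU)
  have hpos := (isOpen_interior.inter (hu.isOpen_support)).measure_ne_zero μ hne
  exact fun h0 => hpos (measure_mono_null (Set.inter_subset_inter_left _ interior_subset) h0)


/-! ### The Dirichlet form -/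

section

variable {α : ℝ}

/-- The attractor is compact, so each `u` in 𝓕 is its own approximation. -/
lemma inducedDomain_eq (h0 : 0 < α) (h1 : α < 1 / 3) (μ : Measure (attractor α)) :
    inducedDomain α μ = F α := by
  have : CompactSpace (attractor α) := isCompact_iff_compactSpace.1 (isCompact_attractor h0 h1)
  refine Set.Subset.antisymm (fun u hu => hu.1) fun u hu => ⟨hu, fun ε hε =>
    ⟨u, hu, hu.1, HasCompactSupport.of_compactSpace u, ?_⟩⟩
  have hz := (formSpace h0 h1).zero_mem
  have e : energyForm (0 : attractor α → ℝ) 0 = 0 := by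
    simpa using energyForm_smul_left h0 h1 0 hz hz
  rw [sub_self, e]
  simpa using hε

lemma memLp_of_mem_F (h0 : 0 < α) (h1 : α < 1 / 3) (μ : Measure (attractor α))
    [IsFiniteMeasure μ] {u : attractor α → ℝ} (hu : u ∈ F α) : MemLp u 2 μ := by
  have : CompactSpace (attractor α) := isCompact_iff_compactSpace.1 (isCompact_attractor h0 h1)
  exact hu.1.memLp_of_hasCompactSupport (HasCompactSupport.of_compactSpace u)

variable (h0 : 0 < α) (h1 : α < 1 / 3) (μ : Measure (attractor α)) [IsFiniteMeasure μ]

/-- The class of a function of finite energy in `L²`. -/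
def toL2 : formSpace h0 h1 →ₗ[ℝ] Lp ℝ 2 μ where
  toFun u := (memLp_of_mem_F h0 h1 μ u.2).toLp
  map_add' _ _ := rfl
  map_smul' _ _ := rfl

lemma coeFn_toL2 (u : formSpace h0 h1) : (toL2 h0 h1 μ u : attractor α → ℝ) =ᵐ[μ] u.1 :=
  (memLp_of_mem_F h0 h1 μ u.2).coeFn_toLp

lemma norm_toL2_sq (u : formSpace h0 h1) : ‖toL2 h0 h1 μ u‖ ^ 2 = ∫ x, u.1 x ^ 2 ∂μ :=
  norm_toLp_sq (memLp_of_mem_F h0 h1 μ u.2)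

lemma toL2_injective [μ.IsOpenPosMeasure] : Function.Injective (toL2 h0 h1 μ) := by
  intro u v h
  refine Subtype.ext ((Continuous.ae_eq_iff_eq μ u.2.1 v.2.1).1 ?_)
  exact (coeFn_toL2 h0 h1 μ u).symm.trans (h ▸ coeFn_toL2 h0 h1 μ v)

/-- Functions of finite energy are determined by their classes. -/
def domainEquiv [μ.IsOpenPosMeasure] :
    formSpace h0 h1 ≃ₗ[ℝ] LinearMap.range (toL2 h0 h1 μ) :=
  LinearEquiv.ofInjective _ (toL2_injective h0 h1 μ)

lemma domainEquiv_coe [μ.IsOpenPosMeasure] (u : formSpace h0 h1) :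
    (domainEquiv h0 h1 μ u : Lp ℝ 2 μ) = toL2 h0 h1 μ u := rfl

/-- The energy as a bilinear form on classes. -/
def classForm [μ.IsOpenPosMeasure] :
    LinearMap.range (toL2 h0 h1 μ) →ₗ[ℝ] LinearMap.range (toL2 h0 h1 μ) →ₗ[ℝ] ℝ :=
  (bilinearForm h0 h1).compl₁₂ (domainEquiv h0 h1 μ).symm.toLinearMap
    (domainEquiv h0 h1 μ).symm.toLinearMap

lemma classForm_apply [μ.IsOpenPosMeasure] (u v : formSpace h0 h1) :
    classForm h0 h1 μ (domainEquiv h0 h1 μ u) (domainEquiv h0 h1 μ v) = energyForm u.1 v.1 := by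
  simp [classForm, bilinearForm]

lemma classForm_self [μ.IsOpenPosMeasure] (u : formSpace h0 h1) :
    classForm h0 h1 μ (domainEquiv h0 h1 μ u) (domainEquiv h0 h1 μ u) = energy u.1 := by
  rw [classForm_apply, energyForm_self h0 h1 u.2]

/-- Uniform density of 𝓕 in the continuous functions is combined with density of the latter in `L²`.
-/
lemma dense_range_toL2 :
    Dense (LinearMap.range (toL2 h0 h1 μ) : Set (Lp ℝ 2 μ)) := by
  have : CompactSpace (attractor α) := isCompact_iff_compactSpace.1 (isCompact_attractor h0 h1)
  have hd := ContinuousMap.toLp_denseRange (α := attractor α) ℝ ℝ (μ := μ) (p := 2)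
    (by norm_num)
  have hF : Dense {f : C(attractor α, ℝ) | ⇑f ∈ F α} := by
    intro f
    refine Metric.mem_closure_iff.2 fun ε hε => ?_
    obtain ⟨ψ, hψ, h⟩ := exists_mem_F_near h0 h1 f.continuous (half_pos hε)
    refine ⟨⟨ψ, hψ.1⟩, hψ, lt_of_le_of_lt ?_ (half_lt_self hε)⟩
    exact (ContinuousMap.dist_le (half_pos hε).le).2 fun x => (h x).le
  refine (hd.dense_image (ContinuousMap.toLp 2 μ ℝ).continuous hF).mono ?_
  rintro _ ⟨f, hf, rfl⟩
  refine ⟨⟨f, hf⟩, Lp.ext ?_⟩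
  exact (coeFn_toL2 h0 h1 μ ⟨f, hf⟩).trans (ContinuousMap.coeFn_toLp μ f).symm

/-- Domination of the uniform norm gives a continuous uniform limit, which is the candidate that
`mem_F_of_cauchy` needs. Uniform convergence also gives `L²` convergence, as the measure is finite.
-/
lemma exists_limit_of_cauchy [μ.IsOpenPosMeasure] (u : ℕ → formSpace h0 h1)
    (hC : ∀ ε > 0, ∃ N, ∀ m ≥ N, ∀ n ≥ N,
      energy (u m - u n).1 + ‖toL2 h0 h1 μ (u m - u n)‖ ^ 2 < ε) :
    ∃ v : formSpace h0 h1, Tendsto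
      (fun n => energy (u n - v).1 + ‖toL2 h0 h1 μ (u n - v)‖ ^ 2) atTop (𝓝 0) := by
  have : CompactSpace (attractor α) := isCompact_iff_compactSpace.1 (isCompact_attractor h0 h1)
  obtain ⟨C, hCpos, hbound⟩ := exists_sq_le h0 h1 μ
  let f : ℕ → C(attractor α, ℝ) := fun n => ⟨(u n).1, (u n).2.1⟩
  have hcau : CauchySeq f := by
    refine Metric.cauchySeq_iff.2 fun ε hε => ?_
    obtain ⟨N, hN⟩ := hC ((ε / 2) ^ 2 / C) (by positivity)
    refine ⟨N, fun m hm n hn => lt_of_le_of_lt ?_ (half_lt_self hε)⟩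
    refine (ContinuousMap.dist_le (half_pos hε).le).2 fun x => ?_
    have e1 := hN m hm n hn
    rw [norm_toL2_sq, lt_div_iff₀' hCpos] at e1
    have e2 := hbound _ (u m - u n).2 (memLp_of_mem_F h0 h1 μ (u m - u n).2).integrable_sq x
    exact abs_le_of_sq_le_sq (e2.trans e1.le) (half_pos hε).le
  obtain ⟨g, hg⟩ := cauchySeq_tendsto_of_complete hcau
  have hlim : ∀ x, Tendsto (fun m => (u m).1 x) atTop (𝓝 (g x)) := fun x =>
    ((ContinuousEvalConst.continuous_eval_const x).tendsto g).comp hg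
  obtain ⟨hgF, hgE⟩ := mem_F_of_cauchy h0 h1 (fun m => (u m).2) g.continuous hlim fun ε hε => by
    obtain ⟨N, hN⟩ := hC ε hε
    exact ⟨N, fun m hm n hn => lt_of_le_of_lt
      (le_add_of_nonneg_right (sq_nonneg _)) (hN m hm n hn)⟩
  refine ⟨⟨g, hgF⟩, ?_⟩
  have hL : Tendsto (fun n => ‖toL2 h0 h1 μ (u n - ⟨g, hgF⟩)‖ ^ 2) atTop (𝓝 0) := by
    have e1 := ((ContinuousMap.toLp (E := ℝ) 2 μ ℝ).continuous.tendsto g).comp hg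
    have e2 := (tendsto_iff_norm_sub_tendsto_zero.1 e1).pow 2
    rw [zero_pow (by norm_num)] at e2
    exact e2
  simpa using hgE.add hL

lemma abs_unitContraction_sub_le (s t : ℝ) :
    |min (max s 0) 1 - min (max t 0) 1| ≤ |s - t| :=
  (abs_min_sub_min_le_max _ _ _ _).trans (by
    simpa using abs_max_sub_max_le_max s 0 t 0)

/-- The Dirichlet form on `L²(K_α, μ)` given by the energy. -/
def dirichletForm [μ.IsOpenPosMeasure] : DirichletForm μ where
  domain := LinearMap.range (toL2 h0 h1 μ)
  form := classForm h0 h1 μ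
  dense_domain := dense_range_toL2 h0 h1 μ
  symm f g := by
    obtain ⟨u, rfl⟩ := (domainEquiv h0 h1 μ).surjective f
    obtain ⟨v, rfl⟩ := (domainEquiv h0 h1 μ).surjective g
    rw [classForm_apply, classForm_apply, energyForm_comm]
  nonneg f := by
    obtain ⟨u, rfl⟩ := (domainEquiv h0 h1 μ).surjective f
    rw [classForm_self]
    exact energy_nonneg h0 h1 u.2
  complete f hC := by
    obtain ⟨u, rfl⟩ : ∃ u : ℕ → formSpace h0 h1, f = fun n => domainEquiv h0 h1 μ (u n) :=
      ⟨fun n => (domainEquiv h0 h1 μ).symm (f n), by simp⟩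
    simp only [← map_sub, classForm_self, domainEquiv_coe] at hC
    obtain ⟨v, hv⟩ := exists_limit_of_cauchy h0 h1 μ u hC
    refine ⟨domainEquiv h0 h1 μ v, ?_⟩
    simpa only [← map_sub, classForm_self, domainEquiv_coe] using hv
  markov f := by
    obtain ⟨u, rfl⟩ := (domainEquiv h0 h1 μ).surjective f
    obtain ⟨hmem, hle⟩ := comp_mem_F h0 h1 (ψ := fun t => min (max t 0) 1) (by simp)
      abs_unitContraction_sub_le u.2
    refine ⟨domainEquiv h0 h1 μ ⟨_, hmem⟩, ?_, ?_⟩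
    · rw [domainEquiv_coe, domainEquiv_coe]
      filter_upwards [coeFn_toL2 h0 h1 μ ⟨_, hmem⟩, coeFn_toL2 h0 h1 μ u] with x hx hx'
      rw [hx, hx']
      rfl
    · rw [classForm_self, classForm_self]
      exact hle

variable [μ.IsOpenPosMeasure]

lemma eq_of_ae_eq {u : formSpace h0 h1} {v : attractor α → ℝ} (hv : v ∈ F α)
    (h : (toL2 h0 h1 μ u : attractor α → ℝ) =ᵐ[μ] v) : u.1 = v :=
  (Continuous.ae_eq_iff_eq μ u.2.1 hv.1).1 ((coeFn_toL2 h0 h1 μ u).symm.trans h)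

lemma isInducedForm_dirichletForm : IsInducedForm (dirichletForm h0 h1 μ) := by
  rw [IsInducedForm, inducedDomain_eq h0 h1]
  refine ⟨fun f => ⟨?_, ?_⟩, ?_⟩
  · rintro ⟨u, rfl⟩
    exact ⟨u.1, u.2, coeFn_toL2 h0 h1 μ u⟩
  · rintro ⟨u, hu, h⟩
    exact ⟨⟨u, hu⟩, Lp.ext ((coeFn_toL2 h0 h1 μ ⟨u, hu⟩).trans h.symm)⟩
  · intro f g u hu v hv hf hg
    obtain ⟨u', rfl⟩ := (domainEquiv h0 h1 μ).surjective f
    obtain ⟨v', rfl⟩ := (domainEquiv h0 h1 μ).surjective g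
    rw [← eq_of_ae_eq h0 h1 μ hu hf, ← eq_of_ae_eq h0 h1 μ hv hg]
    exact classForm_apply h0 h1 μ u' v'

lemma isLocal_dirichletForm : (dirichletForm h0 h1 μ).IsLocal := by
  intro f g _ _ hd
  obtain ⟨u, rfl⟩ := (domainEquiv h0 h1 μ).surjective f
  obtain ⟨v, rfl⟩ := (domainEquiv h0 h1 μ).surjective g
  refine (classForm_apply h0 h1 μ u v).trans (energyForm_eq_zero_of_disjoint h0 h1 u.2 v.2 ?_)
  exact hd.mono (tsupport_subset_aeSupport u.2.1 (coeFn_toL2 h0 h1 μ u))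
    (tsupport_subset_aeSupport v.2.1 (coeFn_toL2 h0 h1 μ v))

lemma isRegular_dirichletForm : (dirichletForm h0 h1 μ).IsRegular := by
  have : CompactSpace (attractor α) := isCompact_iff_compactSpace.1 (isCompact_attractor h0 h1)
  refine ⟨fun f ε hε => ⟨f, ?_, ?_⟩, fun φ hφ _ ε hε => ?_⟩
  · obtain ⟨u, rfl⟩ := (domainEquiv h0 h1 μ).surjective f
    exact ⟨u.1, u.2.1, HasCompactSupport.of_compactSpace _, coeFn_toL2 h0 h1 μ u⟩
  · simpa using hε
  · obtain ⟨ψ, hψ, h⟩ := exists_mem_F_near h0 h1 hφ hε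
    exact ⟨ψ, hψ.1, HasCompactSupport.of_compactSpace _,
      ⟨domainEquiv h0 h1 μ ⟨ψ, hψ⟩, coeFn_toL2 h0 h1 μ ⟨ψ, hψ⟩⟩, h⟩

end

end Hanoi

end

theorem theorem2 (α : ℝ) (hα₀ : 0 < α) (hα₁ : α < 1 / 3)
    (μ : Measure (Hanoi.attractor α)) [IsFiniteMeasure μ] [μ.IsOpenPosMeasure] :
    Hanoi.inducedDomain α μ = Hanoi.F α ∧
    Hanoi.F α ⊆ {u | MemLp u 2 μ} ∧
    ∃ 𝓓 : DirichletForm μ, Hanoi.IsInducedForm 𝓓 ∧ 𝓓.IsLocal ∧ 𝓓.IsRegular :=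
  ⟨Hanoi.inducedDomain_eq hα₀ hα₁ μ, fun _ hu => Hanoi.memLp_of_mem_F hα₀ hα₁ μ hu,
    Hanoi.dirichletForm hα₀ hα₁ μ, Hanoi.isInducedForm_dirichletForm hα₀ hα₁ μ,
    Hanoi.isLocal_dirichletForm hα₀ hα₁ μ, Hanoi.isRegular_dirichletForm hα₀ hα₁ μ⟩
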